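/- Let $\{0,1\}^n$ be the vertex set of the $n$-dimensional hypercube, with the Hamming distance $d(x,y)=|\{i : x_i\neq y_i\}|$; its edges are the unordered pairs $\{y,z\}$ with $d(y,z)=1$, and the distance from a vertex $x$ to an edge $\{y,z\}$ is $\min(d(x,y),d(x,z))$. (Vertices.) There are constants $\varepsilon_0>0$ and $C>0$ such that for every real $0\le\varepsilon<\varepsilon_0$, every $n\ge 0$ and every set $F\subseteq\{0,1\}^n$ with $|F|<\varepsilon 2^n$, there is a vertex $x\in\{0,1\}^n$ such that for every $0\le k\le n$ $$\frac{|\{y\in F : d(x,y)=k\}|}{|\{y\in\{0,1\}^n : d(x,y)=k\}|}\le C\sqrt{\varepsilon}.$$ (Edges.) There are constants $\varepsilon_1>0$ and $C'>0$ such that for every real $0\le\varepsilon<\varepsilon_1$, every $n\ge 0$ and every set $F'$ of edges of the $n$-dimensional hypercube with $|F'|<\varepsilon n 2^n$, there is a vertex $x\in\{0,1\}^n$ such that for every $0\le k\le n-1$ the fraction of the edges at distance exactly $k$ from $x$ that lie in $F'$ is at most $C'\sqrt{\varepsilon}$. -/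

import Mathlib

namespace HammingCube

/-- The vertex set `{0,1}^n` of the `n`-dimensional hypercube; its metric is `hammingDist`. -/
abbrev Vertex (n : ℕ) : Type := Fin n → Bool

/-- The hypercube graph: two vertices are adjacent when they differ in exactly one coordinate. -/
def graph (n : ℕ) : SimpleGraph (Vertex n) where
  Adj x y := hammingDist x y = 1
  symm := ⟨fun x y h => by rw [hammingDist_comm]; exact h⟩
  loopless := ⟨fun x h => by simp at h⟩

instance graphDecidableAdj (n : ℕ) : DecidableRel (graph n).Adj :=
  fun x y => inferInstanceAs (Decidable (hammingDist x y = 1))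

/-- The sphere of radius `k` about `x`: all vertices at Hamming distance exactly `k` from `x`. -/
def sphere {n : ℕ} (x : Vertex n) (k : ℕ) : Finset (Vertex n) :=
  Finset.univ.filter fun y => hammingDist x y = k

/-- The distance from a vertex to an (unordered) edge: the distance to the closer endpoint. -/
def edgeDist {n : ℕ} (x : Vertex n) (e : Sym2 (Vertex n)) : ℕ :=
  Sym2.lift ⟨fun a b => min (hammingDist x a) (hammingDist x b), fun _ _ => min_comm _ _⟩ e

/-- The sphere of edges of radius `k` about `x`: all edges of the hypercube at distance
exactly `k` from `x`. -/
def edgeSphere {n : ℕ} (x : Vertex n) (k : ℕ) : Finset (Sym2 (Vertex n)) :=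
  (graph n).edgeFinset.filter fun e => edgeDist x e = k

/-- The fraction of the elements of the (nonempty) finite set `S` that lie in `F`. -/
noncomputable def fraction {α : Type*} [DecidableEq α] (F S : Finset α) : ℝ :=
  ((S ∩ F).card : ℝ) / (S.card : ℝ)

end HammingCube

/-! The aim is a spherical maximal inequality with constants independent of `n`: for a function with
values in [0,1] and mean at most ε, all spherical means are O(√ε) off a set too small to cover the
cube. Spherical means are diagonal in the characters: the mean of radius k multiplies a character of
degree x by `krawN n k x`. For radii 2j ≤ n/2, this mean is compared with the average of the first j
+ 1 even powers of the simple random walk. Those averages obey a weak (1,1) inequality by Hopf's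
lemma (`exists_ergodicAvg_le`). The difference is dominated pointwise by a square function, and
Parseval turns its L² bound into the scalar bound `square_function_mult_le`, uniform in n and x.
Even radii matter because odd spherical means act by -1 on the top character, while the two-step
walk fixes it. The scalar bound needs decay of Krawtchouk values (`abs_krawN_mul_sq_le`) and
smoothness in the radius. The latter follows from `krawN_sub_krawN`: a difference of values at radii
k and k + 2 is a factor comparable to the spectral gap times a Krawtchouk value in dimension two
lower. Odd radii reduce to even ones by one step of the walk (`sphereMean_succ_le`), and radii
beyond n/2 by the antipodal map. Averaging the four functions involved lets a single vertex serve
every radius. For edges, the same theorem is applied to the density of F' among the edges at a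
vertex. -/

namespace HammingCube
open Polynomial

/-! ### Krawtchouk polynomials: symmetry, reflection, differences in the radius -/

/-- The Krawtchouk polynomial, as a coefficient of its generating function. -/
noncomputable def kraw (n k x : ℕ) : ℝ := ((1 - X) ^ x * (1 + X) ^ (n - x) : ℝ[X]).coeff k

/-- The Krawtchouk polynomial normalised by its value at `0`. -/
noncomputable def krawN (n k x : ℕ) : ℝ := kraw n k x / n.choose k

lemma coeff_prod_one_add_mul_X {ι : Type*} [DecidableEq ι] (s : Finset ι) (a : ι → ℝ) (k : ℕ) :
    (∏ i ∈ s, (1 + C (a i) * X)).coeff k = ∑ t ∈ s.powersetCard k, ∏ i ∈ t, a i := by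
  simp only [Finset.prod_one_add, finsetSum_coeff, Finset.prod_mul_distrib, Finset.prod_const,
    ← map_prod, coeff_C_mul, coeff_X_pow, mul_ite, mul_one, mul_zero]
  rw [← Finset.sum_filter]
  refine Finset.sum_congr ?_ fun _ _ => rfl
  ext t
  simp [Finset.mem_powersetCard, eq_comm]

lemma prod_sign_univ {n : ℕ} (S : Finset (Fin n)) :
    ∏ i, (1 + C (if i ∈ S then (-1 : ℝ) else 1) * X) = (1 - X) ^ S.card * (1 + X) ^ (n - S.card) := by
  have h : ∀ i, (1 + C (if i ∈ S then (-1 : ℝ) else 1) * X) = if i ∈ S then 1 - X else 1 + X := by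
    intro i
    split_ifs <;> simp [sub_eq_add_neg]
  simp only [h, Finset.prod_ite, Finset.prod_const, Finset.filter_mem_eq_inter, Finset.univ_inter]
  congr 2
  rw [Finset.filter_not, Finset.filter_mem_eq_inter, Finset.univ_inter, ← Finset.compl_eq_univ_sdiff,
    Finset.card_compl, Fintype.card_fin]

lemma sum_sign_eq_kraw {n : ℕ} (S : Finset (Fin n)) (k : ℕ) :
    ∑ t ∈ (Finset.univ : Finset (Fin n)).powersetCard k, ∏ i ∈ t, (if i ∈ S then (-1 : ℝ) else 1)
      = kraw n k S.card := by
  rw [← coeff_prod_one_add_mul_X, prod_sign_univ, kraw]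

lemma prod_sign_comm {n : ℕ} (S t : Finset (Fin n)) :
    ∏ i ∈ t, (if i ∈ S then (-1 : ℝ) else 1) = ∏ i ∈ S, (if i ∈ t then (-1 : ℝ) else 1) := by
  simp only [Finset.prod_ite, Finset.prod_const, Finset.filter_mem_eq_inter, Finset.inter_comm,
    one_pow]

/-- Double counting over pairs of sets of sizes x and k: the sign depends only on the parity of the
size of their intersection. -/
lemma kraw_symm (n k x : ℕ) : n.choose x * kraw n k x = n.choose k * kraw n x k := by
  have key : ∀ k x : ℕ, ∑ S ∈ (Finset.univ : Finset (Fin n)).powersetCard x,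
      ∑ t ∈ (Finset.univ : Finset (Fin n)).powersetCard k,
        ∏ i ∈ t, (if i ∈ S then (-1 : ℝ) else 1) = n.choose x * kraw n k x := by
    intro k x
    rw [Finset.sum_congr rfl (g := fun _ => kraw n k x)]
    · simp
    · intro S hS
      rw [sum_sign_eq_kraw, (Finset.mem_powersetCard.1 hS).2]
  rw [← key, ← key, Finset.sum_comm]
  simp only [prod_sign_comm]

lemma choose_cast_pos {n k : ℕ} (h : k ≤ n) : (0 : ℝ) < n.choose k := by
  exact_mod_cast Nat.choose_pos h

lemma krawN_symm {n k x : ℕ} (hk : k ≤ n) (hx : x ≤ n) : krawN n k x = krawN n x k := by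
  rw [krawN, krawN, div_eq_div_iff (choose_cast_pos hk).ne' (choose_cast_pos hx).ne']
  linarith [kraw_symm n k x]

/-- Substituting -X for X exchanges the two factors of the generating function. -/
lemma kraw_reflect {n x : ℕ} (k : ℕ) (hx : x ≤ n) :
    kraw n k (n - x) = (-1) ^ k * kraw n k x := by
  have h := comp_C_mul_X_coeff (p := ((1 - X) ^ x * (1 + X) ^ (n - x) : ℝ[X])) (r := -1) (n := k)
  rw [kraw, kraw, mul_comm ((-1) ^ k), ← h]
  congr 1
  simp only [mul_comp, pow_comp, sub_comp, add_comp, one_comp, X_comp, map_neg, map_one, neg_one_mul,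
    sub_neg_eq_add, Nat.sub_sub_self hx]
  rw [mul_comm, sub_eq_add_neg]

lemma kraw_zero (n k : ℕ) : kraw n k 0 = n.choose k := by
  simp [kraw, coeff_one_add_X_pow]

lemma krawN_zero {n k : ℕ} (hk : k ≤ n) : krawN n k 0 = 1 := by
  rw [krawN, kraw_zero, div_self (choose_cast_pos hk).ne']

lemma krawN_reflect {n x : ℕ} (k : ℕ) (hx : x ≤ n) :
    krawN n k (n - x) = (-1) ^ k * krawN n k x := by
  rw [krawN, krawN, kraw_reflect k hx, mul_div_assoc]

lemma krawN_radius_zero (n x : ℕ) : krawN n 0 x = 1 := by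
  simp [krawN, kraw, coeff_zero_eq_eval_zero]

lemma krawN_one {n x : ℕ} (hn : 0 < n) (hx : x ≤ n) : krawN n 1 x = 1 - 2 * x / n := by
  have hn' : (n : ℝ) ≠ 0 := by positivity
  rw [krawN_symm hn hx, krawN, kraw]
  obtain ⟨m, rfl⟩ : ∃ m, n = m + 1 := ⟨n - 1, by omega⟩
  simp only [pow_one, Nat.add_sub_cancel, sub_mul, one_mul, coeff_sub, coeff_one_add_X_pow]
  have hc := (choose_cast_pos hx).ne'
  rcases x with _ | y
  · simp
  · rw [coeff_X_mul, coeff_one_add_X_pow, div_eq_iff hc]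
    have h1 : ((m + 1).choose (y + 1) : ℝ) = m.choose y + m.choose (y + 1) := by
      exact_mod_cast Nat.choose_succ_succ m y
    have h2 : ((m : ℝ) + 1) * m.choose y = (m + 1).choose (y + 1) * (y + 1) := by
      exact_mod_cast Nat.add_one_mul_choose_eq m y
    push_cast at hn' ⊢
    have h3 : (m.choose y : ℝ) = (m + 1).choose (y + 1) * (y + 1) / (m + 1) := by
      rw [eq_div_iff hn', ← h2]; ring
    have h4 : (m.choose (y + 1) : ℝ) = (m + 1).choose (y + 1) - m.choose y := by linarith
    rw [h4, h3]
    ring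

lemma choose_add_two_mul {m y : ℕ} (hy : y ≤ m) :
    ((m : ℝ) + 2) * (m + 1) * m.choose y
      = (m + 2).choose (y + 1) * ((y + 1) * (m + 1 - y)) := by
  have h1 : ((m : ℝ) + 1 + 1) * (m + 1).choose y = (m + 2).choose (y + 1) * (y + 1) := by
    exact_mod_cast Nat.add_one_mul_choose_eq (m + 1) y
  have h2 : (((m : ℝ) + 1) * m.choose y) = (m + 1).choose y * (m + 1 - y) := by
    have := Nat.add_one_mul_choose_eq m (m - y)
    have e : m - y + 1 = m + 1 - y := by omega
    rw [Nat.choose_symm hy, e, Nat.choose_symm (by omega : y ≤ m + 1)] at this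
    have h : ((m + 1 - y : ℕ) : ℝ) = m + 1 - y := by push_cast [Nat.le_succ_of_le hy]; ring
    rw [← h]
    exact_mod_cast this
  linear_combination (m + 1 - y : ℝ) * h1 + (m + 2 : ℝ) * h2

/-- After exchanging radius and degree, the two generating functions share a factor and differ by (1
+ X)² - (1 - X)² = 4X. -/
lemma krawN_sub_krawN {m k y : ℕ} (hk : k ≤ m) (hy : y ≤ m) :
    krawN (m + 2) k (y + 1) - krawN (m + 2) (k + 2) (y + 1)
      = 4 * ((y + 1) * (m + 1 - y)) / ((m + 2) * (m + 1)) * krawN m k y := by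
  rw [krawN_symm (n := m + 2) (k := k) (by omega) (by omega),
    krawN_symm (n := m + 2) (k := k + 2) (by omega) (by omega), krawN_symm hk hy]
  have key : kraw (m + 2) (y + 1) k - kraw (m + 2) (y + 1) (k + 2) = 4 * kraw m y k := by
    simp only [kraw]
    rw [← coeff_sub]
    have : ((1 - X) ^ k * (1 + X) ^ (m + 2 - k) - (1 - X) ^ (k + 2) * (1 + X) ^ (m + 2 - (k + 2)) : ℝ[X])
        = C 4 * (X * ((1 - X) ^ k * (1 + X) ^ (m - k))) := by
      have e1 : m + 2 - k = (m - k) + 2 := by omega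
      have e2 : m + 2 - (k + 2) = m - k := by omega
      rw [e1, e2]
      have : (C 4 : ℝ[X]) = 4 := rfl
      rw [this]
      ring
    rw [this, coeff_C_mul, coeff_X_mul]
  have h1 := (choose_cast_pos hy).ne'
  have h2 := (choose_cast_pos (show y + 1 ≤ m + 2 by omega)).ne'
  have h3 : ((m : ℝ) + 2) * (m + 1) ≠ 0 := by positivity
  rw [krawN, krawN, krawN, ← sub_div, key, div_mul_div_comm, div_eq_div_iff h2 (mul_ne_zero h3 h1)]
  linear_combination 4 * kraw m y k * choose_add_two_mul hy

/-! ### Decay of Krawtchouk values -/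

/-- The generating function of the `k`-subsets of `m + 2 * x` points that split none of `x` given
disjoint pairs. -/
noncomputable def pairPoly (m x : ℕ) : ℕ[X] := (1 + X ^ 2) ^ x * (1 + X) ^ m

lemma abs_coeff_one_sub_sq_pow_mul_le (m x k : ℕ) :
    |((1 - X ^ 2) ^ x * (1 + X) ^ m : ℝ[X]).coeff k| ≤ ((pairPoly m x).coeff k : ℝ) := by
  induction x generalizing k with
  | zero => simp [pairPoly, coeff_one_add_X_pow]
  | succ x ih =>
    have e1 : ((1 - X ^ 2) ^ (x + 1) * (1 + X) ^ m : ℝ[X])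
        = (1 - X ^ 2) ^ x * (1 + X) ^ m - (1 - X ^ 2) ^ x * (1 + X) ^ m * X ^ 2 := by ring
    have e2 : pairPoly m (x + 1) = pairPoly m x + pairPoly m x * X ^ 2 := by
      unfold pairPoly; ring
    rw [e1, e2, coeff_sub, coeff_add, coeff_mul_X_pow', coeff_mul_X_pow']
    push_cast
    refine (abs_sub _ _).trans (add_le_add (ih k) ?_)
    split_ifs
    · exact ih _
    · simp

/-- Pairing each factor 1 - X with a factor 1 + X gives (1 - X²)^x (1 + X)^(n - 2x); then all signs
are made positive. -/
lemma abs_kraw_le {n x : ℕ} (k : ℕ) (hx : 2 * x ≤ n) :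
    |kraw n k x| ≤ ((pairPoly (n - 2 * x) x).coeff k : ℝ) := by
  convert abs_coeff_one_sub_sq_pow_mul_le (n - 2 * x) x k using 2
  rw [kraw]
  congr 1
  rw [show n - x = x + (n - 2 * x) by omega, pow_add, ← mul_assoc, ← mul_pow]
  ring

/-- Releasing a pair only adds the subsets that split it: (1 + X)² = (1 + X²) + 2X. -/
lemma coeff_pairPoly_succ_le (m x k : ℕ) :
    (pairPoly m (x + 1)).coeff k ≤ (pairPoly (m + 2) x).coeff k := by
  have : pairPoly (m + 2) x = pairPoly m (x + 1) + 2 * (X * ((1 + X ^ 2) ^ x * (1 + X) ^ m)) := by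
    unfold pairPoly; ring
  rw [this, coeff_add]
  exact Nat.le_add_right _ _

lemma coeff_pairPoly_add_le (m x y k : ℕ) :
    (pairPoly m (x + y)).coeff k ≤ (pairPoly (m + 2 * y) x).coeff k := by
  induction y generalizing m with
  | zero => simp
  | succ y ih =>
    refine (coeff_pairPoly_succ_le m (x + y) k).trans ((ih (m + 2)).trans (le_of_eq ?_))
    congr 2; ring

/-- By Pascal's rule twice, the omitted term counts the k-subsets splitting a given pair; δ is a
lower bound for their proportion. -/
lemma choose_split_le {n k : ℕ} (hk : 2 ≤ k) (hkn : k ≤ n) {δ : ℝ}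
    (hδ : δ * ((n + 2) * (n + 1)) ≤ 2 * (k * (n + 2 - k))) :
    (n.choose k : ℝ) + n.choose (k - 2) ≤ (1 - δ) * (n + 2).choose k := by
  obtain ⟨j, rfl⟩ : ∃ j, k = j + 2 := ⟨k - 2, by omega⟩
  have h1 : ((n + 2).choose (j + 2) : ℝ)
      = n.choose j + 2 * n.choose (j + 1) + n.choose (j + 2) := by
    have : (n + 2).choose (j + 2) = n.choose j + 2 * n.choose (j + 1) + n.choose (j + 2) := by
      rw [Nat.choose_succ_succ, Nat.choose_succ_succ, Nat.choose_succ_succ]; ring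
    exact_mod_cast this
  have h2 := choose_add_two_mul (m := n) (y := j + 1) (by omega)
  have hc : (0 : ℝ) < (n + 2).choose (j + 2) := choose_cast_pos (by omega)
  have h3 : δ * (n + 2).choose (j + 2) ≤ 2 * n.choose (j + 1) := by
    have hp : (0 : ℝ) < (n + 2) * (n + 1) := by positivity
    refine le_of_mul_le_mul_left ?_ hp
    push_cast at h2 hδ
    have := mul_le_mul_of_nonneg_right hδ hc.le
    have e : (j : ℝ) + 1 + 1 = j + 2 := by ring
    rw [show j + 1 + 1 = j + 2 from rfl, e] at h2
    nlinarith
  simp only [Nat.add_sub_cancel]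
  linarith

/-- Pairs are imposed one at a time. At every stage A bounds the chosen points from below, B the
unchosen ones, and N bounds the total from above, so each pair costs at least the stated factor. -/
lemma coeff_pairPoly_le {A B : ℝ} {N : ℕ} (hA : 0 < A) (hB : 0 < B) (y : ℕ) :
    ∀ m k : ℕ, A + 2 * y ≤ k → k + B ≤ m → m + 2 * y ≤ N → 2 * (A * B) ≤ N ^ 2 →
      ((pairPoly m y).coeff k : ℝ) ≤ (1 - 2 * (A * B) / N ^ 2) ^ y * (m + 2 * y).choose k := by
  induction y with
  | zero =>
    intro m k _ _ _ _
    simp [pairPoly, coeff_one_add_X_pow]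
  | succ y ih =>
    intro m k h1 h2 h3 h4
    push_cast at h1
    have hk2 : 2 ≤ k := by
      have : (2 : ℝ) ≤ k := by nlinarith [Nat.cast_nonneg (α := ℝ) y]
      exact_mod_cast this
    have hkm : k ≤ m := by
      have : (k : ℝ) ≤ m := by linarith
      exact_mod_cast this
    have hN : 0 < (N : ℝ) := by
      have : 0 < N := by omega
      exact_mod_cast this
    have hθ : 0 ≤ 1 - 2 * (A * B) / N ^ 2 := by
      rw [sub_nonneg, div_le_one (by positivity)]; exact h4
    have e2 : pairPoly m (y + 1) = pairPoly m y + pairPoly m y * X ^ 2 := by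
      unfold pairPoly; ring
    rw [e2, coeff_add, coeff_mul_X_pow', if_pos hk2]
    push_cast
    have i1 := ih m k (by linarith) h2 (by omega) h4
    have i2 := ih m (k - 2) (by push_cast [hk2]; linarith) (by push_cast [hk2]; linarith)
      (by omega) h4
    have i3 : ((m + 2 * y).choose k : ℝ) + (m + 2 * y).choose (k - 2)
        ≤ (1 - 2 * (A * B) / N ^ 2) * (m + 2 * y + 2).choose k := by
      refine choose_split_le hk2 (by omega) ?_
      have hN' : ((m + 2 * y : ℕ) : ℝ) + 2 ≤ N := by
        have : m + 2 * y + 2 ≤ N := by omega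
        exact_mod_cast this
      have hx0 : (0 : ℝ) ≤ ((m + 2 * y : ℕ) : ℝ) := Nat.cast_nonneg _
      rw [div_mul_eq_mul_div, div_le_iff₀ (by positivity), mul_assoc]
      have hkA : A ≤ k := by linarith [Nat.cast_nonneg (α := ℝ) y]
      have hkB : B ≤ ((m + 2 * y : ℕ) : ℝ) + 2 - k := by
        push_cast; linarith [Nat.cast_nonneg (α := ℝ) y]
      have a1 := mul_le_mul hkA hkB hB.le (by linarith)
      have a2 : (((m + 2 * y : ℕ) : ℝ) + 2) * (((m + 2 * y : ℕ) : ℝ) + 1) ≤ N ^ 2 := by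
        rw [sq]; gcongr; linarith
      have a3 : 0 < A * B := mul_pos hA hB
      calc 2 * (A * B * ((((m + 2 * y : ℕ) : ℝ) + 2) * (((m + 2 * y : ℕ) : ℝ) + 1)))
          ≤ 2 * (A * B * N ^ 2) := by gcongr
        _ ≤ 2 * (k * (((m + 2 * y : ℕ) : ℝ) + 2 - k) * N ^ 2) := by gcongr
        _ = _ := by ring
    rw [show m + 2 * (y + 1) = m + 2 * y + 2 by ring, pow_succ, mul_assoc]
    calc _ ≤ (1 - 2 * (A * B) / N ^ 2) ^ y * (((m + 2 * y).choose k : ℝ) + (m + 2 * y).choose (k - 2)) := by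
          rw [mul_add]; exact add_le_add i1 i2
      _ ≤ _ := by gcongr

/-- Only x/4 pairs are kept, so that at least k/2 chosen and n/4 unchosen points remain throughout.
-/
lemma abs_krawN_le_pow {n k x : ℕ} (hk : 2 * k ≤ n) (hxk : x ≤ k) (hk0 : 0 < k) :
    |krawN n k x| ≤ (1 - k / (4 * n)) ^ (x / 4) := by
  have hn : (0 : ℝ) < n := by
    have : 0 < n := by omega
    exact_mod_cast this
  have hk' : (0 : ℝ) < k := by exact_mod_cast hk0
  have hc : (0 : ℝ) < n.choose k := choose_cast_pos (by omega)
  have h2k : 2 * (k : ℝ) ≤ n := by exact_mod_cast hk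
  rw [krawN, abs_div, abs_of_pos hc, div_le_iff₀ hc]
  refine (abs_kraw_le k (by omega)).trans ?_
  have h1 : (pairPoly (n - 2 * x) x).coeff k ≤ (pairPoly (n - 2 * (x / 4)) (x / 4)).coeff k := by
    have := coeff_pairPoly_add_le (n - 2 * x) (x / 4) (x - x / 4) k
    rwa [show x / 4 + (x - x / 4) = x by omega,
      show n - 2 * x + 2 * (x - x / 4) = n - 2 * (x / 4) by omega] at this
  have hy : 4 * ((x / 4 : ℕ) : ℝ) ≤ k := by
    have : 4 * (x / 4) ≤ k := by omega
    exact_mod_cast this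
  have h2 := coeff_pairPoly_le (A := k / 2) (B := n / 4) (N := n) (by positivity) (by positivity)
    (x / 4) (n - 2 * (x / 4)) k (by linarith)
    (by push_cast [show 2 * (x / 4) ≤ n by omega]; linarith) (by omega) (by nlinarith)
  rw [show n - 2 * (x / 4) + 2 * (x / 4) = n by omega] at h2
  refine le_trans (by exact_mod_cast h1) (h2.trans_eq ?_)
  congr 3
  field_simp

lemma abs_krawN_mul_sq_le_of_le {n k x : ℕ} (hk : 2 * k ≤ n) (hxk : x ≤ k) :
    |krawN n k x| * (1 + 4 * k * x / n) ^ 2 ≤ 32768 := by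
  rcases Nat.eq_zero_or_pos k with rfl | hk0
  · obtain rfl : x = 0 := by omega
    norm_num [krawN_radius_zero]
  have hn : (0 : ℝ) < n := by
    have : 0 < n := by omega
    exact_mod_cast this
  have h2k : 2 * (k : ℝ) ≤ n := by exact_mod_cast hk
  set u : ℝ := k * x / (16 * n) with hu
  have hu0 : 0 ≤ u := by positivity
  have h1 : |krawN n k x| ≤ Real.exp (3 / 32 - u) := by
    refine (abs_krawN_le_pow hk hxk hk0).trans ?_
    have h0 : (k : ℝ) / (4 * n) ≤ 1 := by rw [div_le_one (by positivity)]; linarith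
    calc (1 - k / (4 * n) : ℝ) ^ (x / 4) ≤ Real.exp (-(k / (4 * n))) ^ (x / 4) := by
          refine pow_le_pow_left₀ (by linarith) ?_ _
          have := Real.add_one_le_exp (-((k : ℝ) / (4 * n)))
          linarith
      _ = Real.exp (-(k / (4 * n)) * (x / 4 : ℕ)) := by
          rw [← Real.exp_nat_mul, mul_comm]
      _ ≤ _ := by
          rw [Real.exp_le_exp]
          have hy : (x : ℝ) - 3 ≤ 4 * ((x / 4 : ℕ) : ℝ) := by
            have : x ≤ 4 * (x / 4) + 3 := by omega
            have : (x : ℝ) ≤ 4 * ((x / 4 : ℕ) : ℝ) + 3 := by exact_mod_cast this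
            linarith
          have hv : (k : ℝ) / (16 * n) ≤ 1 / 32 := by
            rw [div_le_div_iff₀ (by positivity) (by norm_num)]; linarith
          have hv0 : 0 ≤ (k : ℝ) / (16 * n) := by positivity
          have e1 : (k : ℝ) / (4 * n) = 4 * (k / (16 * n)) := by field_simp; norm_num
          have e2 : u = (k / (16 * n)) * x := by rw [hu]; ring
          rw [e1, e2]
          nlinarith
  have h2 : (4 * k * x / n : ℝ) = 64 * u := by rw [hu]; field_simp; ring
  -- The exponent is chosen so that squaring yields exp(u - 1), which cancels the decay exp(-u).
  have h3 : 1 + 64 * u ≤ 128 * Real.exp (u / 2 - 1 / 2) := by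
    have := Real.add_one_le_exp (u / 2 - 1 / 2)
    linarith
  rw [h2]
  calc |krawN n k x| * (1 + 64 * u) ^ 2
      ≤ Real.exp (3 / 32 - u) * (128 * Real.exp (u / 2 - 1 / 2)) ^ 2 := by gcongr
    _ = 16384 * Real.exp (3 / 32 - 1) := by
        rw [mul_pow, ← Real.exp_nat_mul, mul_left_comm, ← Real.exp_add]
        norm_num
        ring
    _ ≤ 16384 * 1 := by
        gcongr
        rw [Real.exp_le_one_iff]; norm_num
    _ ≤ _ := by norm_num

/-- Symmetry reduces to x ≤ k and reflection to 2x ≤ n. The second power of the weight is what later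
makes the scaled radius differences decay. -/
lemma abs_krawN_mul_sq_le {n k x : ℕ} (hk : 2 * k ≤ n) (hx : x ≤ n) :
    |krawN n k x| * (1 + k * (4 * x * (n - x) / n ^ 2)) ^ 2 ≤ 32768 := by
  have key : ∀ x : ℕ, 2 * x ≤ n → |krawN n k x| * (1 + k * (4 * x * (n - x) / n ^ 2)) ^ 2 ≤ 32768 := by
    intro x hx
    have h : |krawN n k x| * (1 + 4 * k * x / n) ^ 2 ≤ 32768 := by
      rcases le_total x k with h | h
      · exact abs_krawN_mul_sq_le_of_le hk h
      · rw [krawN_symm (by omega) (by omega), mul_right_comm 4]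
        exact abs_krawN_mul_sq_le_of_le hx h
    refine le_trans ?_ h
    rcases Nat.eq_zero_or_pos n with rfl | hn0
    · simp
    have hn : (0 : ℝ) < n := by exact_mod_cast hn0
    have hxn : (x : ℝ) ≤ n := by
      have : x ≤ n := by omega
      exact_mod_cast this
    have h1 : (k : ℝ) * (4 * x * (n - x) / n ^ 2) ≤ 4 * k * x / n := by
      rw [mul_div_assoc', div_le_div_iff₀ (by positivity) hn]
      have : (0 : ℝ) ≤ 4 * k * x * n * x := by positivity
      nlinarith
    have h0 : (0 : ℝ) ≤ k * (4 * x * (n - x) / n ^ 2) := by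
      have : (0 : ℝ) ≤ n - x := by linarith
      positivity
    gcongr
  rcases le_total (2 * x) n with h | h
  · exact key x h
  · have := key (n - x) (by omega)
    rw [krawN_reflect k hx, abs_mul, abs_pow, abs_neg, abs_one, one_pow, one_mul] at this
    push_cast [hx] at this
    convert this using 4
    ring

/-! ### Cesàro averages of powers -/

/-- The Cesàro averages of the powers of `r`. -/
noncomputable def cesaro (r : ℝ) (k : ℕ) : ℝ := (∑ i ∈ Finset.range (k + 1), r ^ i) / (k + 1)

section
variable {r : ℝ} (h0 : 0 ≤ r) (h1 : r ≤ 1) (k : ℕ)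
include h0

lemma cesaro_nonneg : 0 ≤ cesaro r k := by
  unfold cesaro; positivity

include h1

lemma one_sub_le_pow {i : ℕ} (hi : i ≤ k) : 1 - k * (1 - r) ≤ r ^ i := by
  have := one_add_mul_le_pow (show -2 ≤ r - 1 by linarith) i
  have hik : (i : ℝ) ≤ k := by exact_mod_cast hi
  rw [add_sub_cancel] at this
  nlinarith

lemma one_sub_le_cesaro : 1 - k * (1 - r) ≤ cesaro r k := by
  rw [cesaro, le_div_iff₀ (by positivity)]
  have := Finset.card_nsmul_le_sum (Finset.range (k + 1)) (fun i => r ^ i) (1 - k * (1 - r))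
    fun i hi => one_sub_le_pow h0 h1 k (Nat.lt_succ_iff.1 (Finset.mem_range.1 hi))
  rw [Finset.card_range, nsmul_eq_mul] at this
  push_cast at this
  linarith

lemma cesaro_le_one : cesaro r k ≤ 1 := by
  rw [cesaro, div_le_one (by positivity)]
  have := Finset.sum_le_card_nsmul (Finset.range (k + 1)) (fun i => r ^ i) 1
    fun i _ => pow_le_one₀ h0 h1
  simpa using this

lemma pow_le_cesaro : r ^ (k + 1) ≤ cesaro r k := by
  rw [cesaro, le_div_iff₀ (by positivity)]
  have := Finset.card_nsmul_le_sum (Finset.range (k + 1)) (fun i => r ^ i) (r ^ (k + 1))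
    fun i hi => pow_le_pow_of_le_one h0 h1 (Finset.mem_range.1 hi).le
  rw [Finset.card_range, nsmul_eq_mul] at this
  push_cast at this
  linarith

lemma cesaro_mul_le_two : cesaro r k * (1 + (k + 1) * (1 - r)) ≤ 2 := by
  have e : cesaro r k * ((k + 1) * (1 - r)) = 1 - r ^ (k + 1) := by
    rw [cesaro, ← mul_neg_geom_sum, ← mul_assoc, div_mul_cancel₀ _ (by positivity), mul_comm]
  have := cesaro_le_one h0 h1 k
  have := pow_nonneg h0 (k + 1)
  linarith

/-- The exact increment is (k + 2)(c_{k+1} - c_k) = r^(k+1) - c_k, where c denotes `cesaro r`. -/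
lemma abs_cesaro_succ_sub_le :
    (k + 1) * |cesaro r (k + 1) - cesaro r k| ≤ (k + 1) * (1 - r) ∧
    (k + 1) * |cesaro r (k + 1) - cesaro r k| ≤ cesaro r k := by
  have e : (k + 2 : ℝ) * (cesaro r (k + 1) - cesaro r k) = r ^ (k + 1) - cesaro r k := by
    rw [cesaro, cesaro, Finset.sum_range_succ _ (k + 1)]
    push_cast
    field_simp
    ring
  have hp := pow_le_cesaro h0 h1 k
  have e' : (k + 2 : ℝ) * |cesaro r (k + 1) - cesaro r k| = cesaro r k - r ^ (k + 1) := by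
    rw [← abs_of_nonneg (show (0 : ℝ) ≤ k + 2 by positivity), ← abs_mul, e, abs_sub_comm,
      abs_of_nonneg (by linarith)]
  have ha := abs_nonneg (cesaro r (k + 1) - cesaro r k)
  have h2 := one_sub_le_pow h0 h1 (k + 1) le_rfl
  have h3 := cesaro_le_one h0 h1 k
  have h4 := pow_nonneg h0 (k + 1)
  push_cast at h2
  constructor <;> nlinarith

end

/-! ### Spectral gap and multiplier bounds -/

/-- The spectral gap `1 - (1 - 2x/n)²` of two steps of the simple random walk on the cube. -/
noncomputable def gap (n x : ℕ) : ℝ := 4 * x * (n - x) / n ^ 2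

lemma gap_nonneg {n x : ℕ} (hx : x ≤ n) : 0 ≤ gap n x := by
  have : (0 : ℝ) ≤ n - x := by rw [sub_nonneg]; exact_mod_cast hx
  unfold gap; positivity

lemma one_sub_gap {n : ℕ} (hn : 0 < n) (x : ℕ) : 1 - gap n x = (1 - 2 * x / n) ^ 2 := by
  have : (n : ℝ) ≠ 0 := by positivity
  unfold gap; field_simp; ring

lemma gap_le_one {n : ℕ} (hn : 0 < n) (x : ℕ) : gap n x ≤ 1 := by
  have := one_sub_gap hn x
  nlinarith [sq_nonneg (1 - 2 * x / n : ℝ)]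

/-- Transfers the decay weight from dimension m to m + 2. At y = 0 and y = m the smaller gap
vanishes, but there the range of i keeps the left side at most 2. -/
lemma one_add_gap_le {m i y : ℕ} (hi : 4 * (i + 1) ≤ m + 2) (hy : y ≤ m) :
    1 + (i + 1) * gap (m + 2) (y + 1) ≤ 8 * (1 + (2 * i : ℕ) * gap m y) := by
  have hg := gap_nonneg hy
  have hi' : 4 * ((i : ℝ) + 1) ≤ m + 2 := by exact_mod_cast hi
  have hm : (0 : ℝ) < m := by
    have : 0 < m := by omega
    exact_mod_cast this
  have small : ((y : ℝ) + 1) * (m + 1 - y) ≤ m + 1 →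
      1 + (i + 1) * gap (m + 2) (y + 1) ≤ 8 * (1 + (2 * i : ℕ) * gap m y) := by
    intro h
    have : (i + 1) * gap (m + 2) (y + 1) ≤ 1 := by
      rw [gap, mul_div_assoc', div_le_one (by positivity)]
      push_cast
      have e : (m : ℝ) + 2 - (y + 1) = m + 1 - y := by ring
      rw [e]
      nlinarith
    have : 0 ≤ ((2 * i : ℕ) : ℝ) * gap m y := by positivity
    linarith
  rcases Nat.eq_zero_or_pos y with rfl | hy0
  · apply small; push_cast; linarith
  rcases hy.eq_or_lt with rfl | hym
  · apply small; linarith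
  rcases Nat.eq_zero_or_pos i with rfl | hi0
  · have := gap_le_one (n := m + 2) (by omega) (y + 1)
    push_cast
    linarith
  have hy1 : (1 : ℝ) ≤ y := by exact_mod_cast hy0
  have hym1 : (1 : ℝ) ≤ m - y := by
    have : y + 1 ≤ m := hym
    have : (y : ℝ) + 1 ≤ m := by exact_mod_cast this
    linarith
  have hi1 : (1 : ℝ) ≤ i := by exact_mod_cast hi0
  have h : gap (m + 2) (y + 1) ≤ 4 * gap m y := by
    rw [gap, gap, mul_div_assoc']
    push_cast
    apply div_le_div₀ (by positivity) _ (by positivity) (by gcongr; linarith)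
    have e : (m : ℝ) + 2 - (y + 1) = m + 1 - y := by ring
    rw [e]
    nlinarith
  have h0 := gap_nonneg (n := m + 2) (x := y + 1) (by omega)
  push_cast
  nlinarith

/-- The constant is 2 · 8² · 32768. The endpoints x = 0 and x = n are separate because the
difference identity needs 0 < x < n; there the difference vanishes. -/
lemma abs_krawN_two_step_le {n x i : ℕ} (hi : 4 * (i + 1) ≤ n) (hx : x ≤ n) :
    |krawN n (2 * (i + 1)) x - krawN n (2 * i) x| * (1 + (i + 1) * gap n x) ^ 2
      ≤ 4194304 * gap n x := by
  have hg := gap_nonneg hx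
  rcases Nat.eq_zero_or_pos x with rfl | hx0
  · rw [krawN_zero (by omega), krawN_zero (by omega)]; simp [hg]
  rcases hx.eq_or_lt with rfl | hxn
  · have h : ∀ j, 2 * j ≤ x → krawN x (2 * j) x = 1 := by
      intro j hj
      have := krawN_reflect (n := x) (x := 0) (2 * j) (by omega)
      rw [Nat.sub_zero, krawN_zero hj] at this
      simpa using this
    rw [h _ (by omega), h _ (by omega)]; simp [hg]
  obtain ⟨m, rfl⟩ : ∃ m, n = m + 2 := ⟨n - 2, by omega⟩
  obtain ⟨y, rfl⟩ : ∃ y, x = y + 1 := ⟨x - 1, by omega⟩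
  have hy : y ≤ m := by omega
  have hm : (0 : ℝ) ≤ m := Nat.cast_nonneg _
  rw [abs_sub_comm, mul_add 2, mul_one, krawN_sub_krawN (by omega) hy, abs_mul]
  have h1 : |4 * ((y + 1) * (m + 1 - y)) / ((m + 2) * (m + 1) : ℝ)| ≤ 2 * gap (m + 2) (y + 1) := by
    have hmy : (0 : ℝ) ≤ m + 1 - y := by
      have : (y : ℝ) ≤ m := by exact_mod_cast hy
      linarith
    rw [abs_of_nonneg (by positivity), gap, mul_div_assoc', div_le_div_iff₀ (by positivity) (by positivity)]
    push_cast
    have e : (m : ℝ) + 2 - (y + 1) = m + 1 - y := by ring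
    rw [e]
    have : 0 ≤ ((y : ℝ) + 1) * (m + 1 - y) * (m + 2) * m := by positivity
    nlinarith
  have h2 := abs_krawN_mul_sq_le (n := m) (k := 2 * i) (x := y) (by omega) hy
  have h3 := one_add_gap_le hi hy
  have h4 : 0 ≤ 1 + (i + 1) * gap (m + 2) (y + 1) := by positivity
  change |krawN m (2 * i) y| * (1 + (2 * i : ℕ) * gap m y) ^ 2 ≤ 32768 at h2
  calc _ ≤ 2 * gap (m + 2) (y + 1) * |krawN m (2 * i) y| * (8 * (1 + (2 * i : ℕ) * gap m y)) ^ 2 := by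
        gcongr
    _ = 128 * gap (m + 2) (y + 1) * (|krawN m (2 * i) y| * (1 + (2 * i : ℕ) * gap m y) ^ 2) := by
        ring
    _ ≤ 128 * gap (m + 2) (y + 1) * 32768 := by gcongr
    _ = _ := by ring

/-- The multiplier of the difference between the spherical mean of radius `2 * j` and the average
of the first `j + 1` even powers of the simple random walk. -/
noncomputable def diffMult (n j x : ℕ) : ℝ := krawN n (2 * j) x - cesaro (1 - gap n x) j

lemma le_of_mul_one_add_sq_le {w t A : ℝ} (hw : 0 ≤ w) (ht : 0 ≤ t) (h : w * (1 + t) ^ 2 ≤ A * t)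
    (hA : 0 ≤ A) : w ≤ A * t ∧ w * (1 + t) ≤ A := by
  constructor
  · nlinarith [mul_nonneg hw ht, mul_nonneg (mul_nonneg hw ht) ht]
  · have : w * (1 + t) * (1 + t) ≤ A * (1 + t) := by nlinarith
    exact le_of_mul_le_mul_right this (by linarith)

lemma abs_one_sub_krawN_le {n x : ℕ} (hx : x ≤ n) (j : ℕ) (hj : 4 * j ≤ n) :
    |1 - krawN n (2 * j) x| ≤ 4194304 * (j * gap n x) := by
  induction j with
  | zero => simp [krawN_radius_zero]
  | succ i ih =>
    have hg := gap_nonneg hx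
    have h1 := ih (by omega)
    have h2 := abs_krawN_two_step_le hj hx
    have h3 : |krawN n (2 * (i + 1)) x - krawN n (2 * i) x| ≤ 4194304 * gap n x := by
      refine le_trans ?_ h2
      refine le_mul_of_one_le_right (abs_nonneg _) (one_le_pow₀ ?_)
      have : 0 ≤ (i + 1) * gap n x := by positivity
      linarith
    have := abs_sub_le 1 (krawN n (2 * i) x) (krawN n (2 * (i + 1)) x)
    rw [abs_sub_comm (krawN n (2 * i) x)] at this
    push_cast
    linarith

/-- With t = j · gap, both multipliers are within O(t) of 1 and both are O(1/(1 + t)). -/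
lemma diffMult_bound {n x : ℕ} (hn : 0 < n) (hx : x ≤ n) (j : ℕ) (hj : 4 * j ≤ n) :
    |diffMult n j x| ≤ 4194306 * (j * gap n x) ∧
      |diffMult n j x| * (1 + j * gap n x) ≤ 4194306 := by
  have hg := gap_nonneg hx
  have hg1 := gap_le_one hn x
  have ht : 0 ≤ j * gap n x := by positivity
  have h0 : 0 ≤ 1 - gap n x := by linarith
  have h1 : 1 - gap n x ≤ 1 := by linarith
  constructor
  · have a := abs_one_sub_krawN_le hx j hj
    have b := one_sub_le_cesaro h0 h1 j
    have c := cesaro_le_one h0 h1 j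
    rw [sub_sub_cancel] at b
    have d := abs_le.1 a
    rw [diffMult, abs_le]
    constructor <;> linarith [d.1, d.2]
  · have a := abs_krawN_mul_sq_le (n := n) (k := 2 * j) (x := x) (by omega) hx
    change |krawN n (2 * j) x| * (1 + (2 * j : ℕ) * gap n x) ^ 2 ≤ 32768 at a
    have b := cesaro_mul_le_two h0 h1 j
    have c := cesaro_nonneg h0 j
    rw [sub_sub_cancel] at b
    have e : |krawN n (2 * j) x| * (1 + j * gap n x) ≤ 32768 := by
      refine le_trans (mul_le_mul_of_nonneg_left ?_ (abs_nonneg _)) a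
      push_cast
      nlinarith
    have f : |diffMult n j x| ≤ |krawN n (2 * j) x| + cesaro (1 - gap n x) j := by
      refine (abs_sub _ _).trans ?_
      rw [abs_of_nonneg c]
    have := mul_le_mul_of_nonneg_right f (show 0 ≤ 1 + j * gap n x by linarith)
    nlinarith

lemma diffMult_succ_bound {n x : ℕ} (hn : 0 < n) (hx : x ≤ n) (i : ℕ) (hi : 4 * (i + 1) ≤ n) :
    (i + 1) * |diffMult n (i + 1) x - diffMult n i x| ≤ 4194306 * ((i + 1) * gap n x) ∧
      (i + 1) * |diffMult n (i + 1) x - diffMult n i x| * (1 + (i + 1) * gap n x) ≤ 4194306 := by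
  have hg := gap_nonneg hx
  have hg1 := gap_le_one hn x
  have ht : 0 ≤ (i + 1) * gap n x := by positivity
  have h0 : 0 ≤ 1 - gap n x := by linarith
  have h1 : 1 - gap n x ≤ 1 := by linarith
  have a := abs_krawN_two_step_le hi hx
  have a' := le_of_mul_one_add_sq_le
    (w := (i + 1) * |krawN n (2 * (i + 1)) x - krawN n (2 * i) x|) (A := 4194304)
    (by positivity) ht (by nlinarith [Nat.cast_nonneg (α := ℝ) i]) (by norm_num)
  have b := abs_cesaro_succ_sub_le h0 h1 i
  have b' := cesaro_mul_le_two h0 h1 i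
  rw [sub_sub_cancel] at b b'
  have f : |diffMult n (i + 1) x - diffMult n i x|
      ≤ |krawN n (2 * (i + 1)) x - krawN n (2 * i) x|
        + |cesaro (1 - gap n x) (i + 1) - cesaro (1 - gap n x) i| := by
    rw [diffMult, diffMult, sub_sub_sub_comm]
    exact abs_sub _ _
  have f' := mul_le_mul_of_nonneg_left f (show (0 : ℝ) ≤ i + 1 by positivity)
  have f'' := mul_le_mul_of_nonneg_right f' (show 0 ≤ 1 + (i + 1) * gap n x by linarith)
  have b'' := mul_le_mul_of_nonneg_right b.2 (show 0 ≤ 1 + (i + 1) * gap n x by linarith)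
  constructor
  · linarith [a'.1, b.1]
  · linarith [a'.2]

lemma sq_le_of_bounds {w t A : ℝ} (hw : 0 ≤ w) (ht : 0 ≤ t) (h1 : w ≤ A * t)
    (h2 : w * (1 + t) ≤ A) : w ^ 2 ≤ 2 * A ^ 2 * (t / (1 + t) ^ 2) := by
  rw [mul_div_assoc', le_div_iff₀ (by positivity), ← mul_pow]
  have hA : 0 ≤ A := le_trans (by positivity) h2
  have h3 : w * t ≤ A * t := mul_le_mul_of_nonneg_right (by nlinarith) ht
  have h4 : 0 ≤ w * (1 + t) := by positivity
  nlinarith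

/-- Each term is at most an increment of Mb/(1 + Mb), which never exceeds 1. -/
lemma sum_gap_le_one {b : ℝ} (hb : 0 ≤ b) (M : ℕ) :
    ∑ i ∈ Finset.range M, b / (1 + (i + 1) * b) ^ 2 ≤ 1 := by
  have key : ∑ i ∈ Finset.range M, b / (1 + (i + 1) * b) ^ 2 ≤ M * b / (1 + M * b) := by
    induction M with
    | zero => simp
    | succ M ih =>
      rw [Finset.sum_range_succ]
      have : b / (1 + (M + 1) * b) ^ 2 ≤ ((M + 1 : ℕ) : ℝ) * b / (1 + (M + 1 : ℕ) * b) - M * b / (1 + M * b) := by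
        push_cast
        have p1 : 0 < 1 + M * b := by positivity
        have p2 : 0 < 1 + (M + 1) * b := by positivity
        rw [div_sub_div _ _ p2.ne' p1.ne']
        have e : ((M : ℝ) + 1) * b * (1 + M * b) - (1 + (M + 1) * b) * (M * b) = b := by ring
        rw [e, sq]
        gcongr
        linarith
      linarith
  refine key.trans ?_
  rw [div_le_one (by positivity)]
  linarith

/-- The square function multiplier is bounded independently of the dimension. -/
lemma square_function_mult_le {n x : ℕ} (hn : 0 < n) (hx : x ≤ n) {M : ℕ} (hM : 4 * M ≤ n) :
    ∑ i ∈ Finset.range M, ((i + 1) * (diffMult n (i + 1) x - diffMult n i x) ^ 2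
      + diffMult n (i + 1) x ^ 2 / (i + 1)) ≤ 4 * 4194306 ^ 2 := by
  have hg := gap_nonneg hx
  have : ∀ i ∈ Finset.range M, ((i + 1) * (diffMult n (i + 1) x - diffMult n i x) ^ 2
      + diffMult n (i + 1) x ^ 2 / (i + 1))
      ≤ 4 * 4194306 ^ 2 * (gap n x / (1 + (i + 1) * gap n x) ^ 2) := by
    intro i hi
    have hi' : 4 * (i + 1) ≤ n := by have := Finset.mem_range.1 hi; omega
    have hp : (0 : ℝ) < i + 1 := by positivity
    obtain ⟨a1, a2⟩ := diffMult_succ_bound hn hx i hi'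
    obtain ⟨b1, b2⟩ := diffMult_bound hn hx (i + 1) hi'
    push_cast at b1 b2
    have ht : 0 ≤ (i + 1) * gap n x := by positivity
    have a := sq_le_of_bounds (by positivity) ht a1 a2
    have b := sq_le_of_bounds (by positivity) ht b1 b2
    rw [mul_pow, sq_abs] at a
    rw [sq_abs] at b
    have e : (i + 1) * gap n x / (1 + (i + 1) * gap n x) ^ 2
        = (i + 1) * (gap n x / (1 + (i + 1) * gap n x) ^ 2) := by ring
    rw [e] at a b
    have a' : (i + 1) * (diffMult n (i + 1) x - diffMult n i x) ^ 2
        ≤ 2 * 4194306 ^ 2 * (gap n x / (1 + (i + 1) * gap n x) ^ 2) := by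
      refine le_of_mul_le_mul_left ?_ hp
      linarith
    have b' : diffMult n (i + 1) x ^ 2 / (i + 1)
        ≤ 2 * 4194306 ^ 2 * (gap n x / (1 + (i + 1) * gap n x) ^ 2) := by
      rw [div_le_iff₀ hp]
      linarith
    linarith
  refine (Finset.sum_le_sum this).trans ?_
  rw [← Finset.mul_sum]
  exact mul_le_of_le_one_right (by norm_num) (sum_gap_le_one hg M)

/-! ### Fourier analysis and spherical means -/

/-- The sign `(-1)^b`. -/
def sgn (b : Bool) : ℝ := if b then -1 else 1

/-- The character of the cube attached to a set of coordinates. -/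
noncomputable def chi {n : ℕ} (S : Finset (Fin n)) (x : Vertex n) : ℝ := ∏ i ∈ S, sgn (x i)

lemma sum_chi_mul_chi {n : ℕ} (x y : Vertex n) :
    ∑ S, chi S x * chi S y = if x = y then (2 : ℝ) ^ n else 0 := by
  simp only [chi, ← Finset.prod_mul_distrib]
  rw [← Finset.powerset_univ, ← Finset.prod_one_add]
  split_ifs with h
  · subst h
    have : ∀ i, 1 + sgn (x i) * sgn (x i) = 2 := by
      intro i; unfold sgn; split_ifs <;> norm_num
    simp [this]
  · obtain ⟨i, hi⟩ := Function.ne_iff.1 h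
    refine Finset.prod_eq_zero (Finset.mem_univ i) ?_
    cases hx : x i <;> cases hy : y i <;> simp_all [sgn]

/-- The Fourier transform on the cube. -/
noncomputable def fourier {n : ℕ} (S : Finset (Fin n)) : (Vertex n → ℝ) →ₗ[ℝ] ℝ where
  toFun f := ∑ x, f x * chi S x
  map_add' f g := by simp [add_mul, Finset.sum_add_distrib]
  map_smul' c f := by simp [mul_assoc, Finset.mul_sum]

lemma fourier_apply {n : ℕ} (S : Finset (Fin n)) (f : Vertex n → ℝ) :
    fourier S f = ∑ x, f x * chi S x := rfl

lemma parseval {n : ℕ} (f : Vertex n → ℝ) :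
    ∑ S, fourier S f ^ 2 = 2 ^ n * ∑ x, f x ^ 2 := by
  simp only [fourier_apply, sq (∑ x, _), Finset.sum_mul_sum]
  rw [Finset.sum_comm]
  simp_rw [Finset.sum_comm (s := (Finset.univ : Finset (Finset (Fin n))))]
  have : ∀ x y : Vertex n, ∑ S, f x * chi S x * (f y * chi S y)
      = if x = y then 2 ^ n * f x ^ 2 else 0 := by
    intro x y
    have e : ∀ S, f x * chi S x * (f y * chi S y) = f x * f y * (chi S x * chi S y) := by
      intro S; ring
    simp only [e]
    rw [← Finset.mul_sum, sum_chi_mul_chi]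
    split_ifs with h
    · subst h; ring
    · simp
  simp [this, Finset.mul_sum]

lemma mem_sphere {n : ℕ} {x y : Vertex n} {k : ℕ} : y ∈ sphere x k ↔ hammingDist x y = k := by
  simp [sphere]

lemma mem_sphere_comm {n : ℕ} {x y : Vertex n} {k : ℕ} : y ∈ sphere x k ↔ x ∈ sphere y k := by
  rw [mem_sphere, mem_sphere, hammingDist_comm]

/-- The sum over the cube factors over coordinates; each coordinate contributes 1 - X or 1 + X
according to membership in S. -/
lemma sum_X_pow_hammingDist {n : ℕ} (S : Finset (Fin n)) (y : Vertex n) :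
    ∑ x : Vertex n, X ^ hammingDist y x * C (chi S x)
      = C (chi S y) * ((1 - X) ^ S.card * (1 + X) ^ (n - S.card)) := by
  have h1 : ∀ x : Vertex n, (X : ℝ[X]) ^ hammingDist y x * C (chi S x)
      = ∏ i, ((if y i ≠ x i then X else 1) * if i ∈ S then C (sgn (x i)) else 1) := by
    intro x
    rw [Finset.prod_mul_distrib, Finset.prod_ite_mem, Finset.univ_inter, chi, map_prod,
      Finset.prod_ite, Finset.prod_const, Finset.prod_const_one, mul_one]
    rfl
  have h2 : C (chi S y) = ∏ i, if i ∈ S then C (sgn (y i)) else 1 := by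
    rw [Finset.prod_ite_mem, Finset.univ_inter, chi, map_prod]
  rw [← prod_sign_univ, h2, ← Finset.prod_mul_distrib]
  simp only [h1]
  rw [← Fintype.piFinset_univ,
    ← Finset.prod_univ_sum (fun _ => Finset.univ) (fun (i : Fin n) (b : Bool) =>
      (if y i ≠ b then X else 1) * if i ∈ S then C (sgn b) else (1 : ℝ[X]))]
  refine Finset.prod_congr rfl fun i _ => ?_
  by_cases hi : i ∈ S <;> cases hy : y i <;>
    simp [hi, sgn, add_comm]

lemma sum_sphere_chi {n : ℕ} (S : Finset (Fin n)) (y : Vertex n) (k : ℕ) :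
    ∑ x ∈ sphere y k, chi S x = kraw n k S.card * chi S y := by
  have h := congrArg (fun p => coeff p k) (sum_X_pow_hammingDist S y)
  simp only [finsetSum_coeff, coeff_mul_C, coeff_C_mul, coeff_X_pow, ite_mul, one_mul, zero_mul] at h
  rw [← Finset.sum_filter] at h
  rw [kraw, mul_comm, ← h]
  refine Finset.sum_congr ?_ fun _ _ => rfl
  simp [sphere, eq_comm]

lemma card_sphere {n : ℕ} (x : Vertex n) (k : ℕ) : (sphere x k).card = n.choose k := by
  have := sum_sphere_chi ∅ x k
  simp only [chi, Finset.prod_empty, Finset.card_empty, kraw_zero, Finset.sum_const, nsmul_eq_mul,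
    mul_one] at this
  exact_mod_cast this

/-- The spherical mean of radius `k`. -/
noncomputable def sphereMean {n : ℕ} (k : ℕ) : (Vertex n → ℝ) →ₗ[ℝ] (Vertex n → ℝ) where
  toFun f x := (∑ y ∈ sphere x k, f y) / n.choose k
  map_add' f g := by ext x; simp [Finset.sum_add_distrib, add_div]
  map_smul' c f := by ext x; simp [← Finset.mul_sum, mul_div_assoc]

lemma sphereMean_apply {n : ℕ} (k : ℕ) (f : Vertex n → ℝ) (x : Vertex n) :
    sphereMean k f x = (∑ y ∈ sphere x k, f y) / n.choose k := rfl

lemma sphereMean_nonneg {n : ℕ} (k : ℕ) {f : Vertex n → ℝ} (hf : 0 ≤ f) : 0 ≤ sphereMean k f :=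
  fun _ => div_nonneg (Finset.sum_nonneg fun y _ => hf y) (Nat.cast_nonneg _)

lemma sum_sum_sphere {n : ℕ} (k : ℕ) (g : Vertex n → Vertex n → ℝ) :
    ∑ x, ∑ y ∈ sphere x k, g x y = ∑ y, ∑ x ∈ sphere y k, g x y :=
  Finset.sum_comm' fun x y => by simp [mem_sphere_comm (x := x)]

lemma sum_sphereMean {n k : ℕ} (hk : k ≤ n) (f : Vertex n → ℝ) :
    ∑ x, sphereMean k f x = ∑ x, f x := by
  simp only [sphereMean_apply]
  rw [← Finset.sum_div, sum_sum_sphere]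
  simp only [Finset.sum_const, card_sphere, nsmul_eq_mul]
  rw [← Finset.mul_sum, mul_div_cancel_left₀ _ (choose_cast_pos hk).ne']

lemma sphereMean_one {n k : ℕ} (hk : k ≤ n) : sphereMean k (1 : Vertex n → ℝ) = 1 := by
  ext x
  simp [sphereMean_apply, card_sphere, (choose_cast_pos hk).ne']

lemma fourier_sphereMean {n : ℕ} (k : ℕ) (S : Finset (Fin n)) (f : Vertex n → ℝ) :
    fourier S (sphereMean k f) = krawN n k S.card * fourier S f := by
  simp only [fourier_apply, sphereMean_apply, div_mul_eq_mul_div, Finset.sum_mul]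
  rw [← Finset.sum_div, sum_sum_sphere]
  simp only [← Finset.mul_sum, sum_sphere_chi, krawN]
  rw [div_mul_eq_mul_div, Finset.mul_sum]
  congr 1
  exact Finset.sum_congr rfl fun _ _ => by ring

/-- Two steps of the simple random walk on the cube. -/
noncomputable def twoStep (n : ℕ) : Module.End ℝ (Vertex n → ℝ) := sphereMean 1 ∘ₗ sphereMean 1

lemma fourier_twoStep_pow {n : ℕ} (hn : 0 < n) (i : ℕ) (S : Finset (Fin n)) (f : Vertex n → ℝ) :
    fourier S ((twoStep n ^ i) f) = (1 - gap n S.card) ^ i * fourier S f := by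
  induction i with
  | zero => simp
  | succ i ih =>
    have hS : S.card ≤ n := by simpa using Finset.card_le_univ S
    rw [pow_succ', Module.End.mul_apply, twoStep, LinearMap.comp_apply, fourier_sphereMean,
      fourier_sphereMean, ← twoStep, ih, krawN_one hn hS, one_sub_gap hn]
    ring

/-- The Cesàro averages of the powers of an operator. -/
noncomputable def ergodicAvg {E : Type*} [AddCommGroup E] [Module ℝ E] (Q : Module.End ℝ E) (k : ℕ) :
    Module.End ℝ E := ((k : ℝ) + 1)⁻¹ • ∑ i ∈ Finset.range (k + 1), Q ^ i

/-- The spherical mean of radius `2 * j` minus the average of the first `j + 1` even powers of the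
simple random walk. -/
noncomputable def diffOp (n j : ℕ) : Module.End ℝ (Vertex n → ℝ) :=
  sphereMean (2 * j) - ergodicAvg (twoStep n) j

lemma fourier_diffOp {n : ℕ} (hn : 0 < n) (j : ℕ) (S : Finset (Fin n)) (f : Vertex n → ℝ) :
    fourier S (diffOp n j f) = diffMult n j S.card * fourier S f := by
  rw [diffOp, LinearMap.sub_apply, map_sub, fourier_sphereMean, ergodicAvg, LinearMap.smul_apply,
    map_smul, LinearMap.sum_apply, map_sum]
  simp only [fourier_twoStep_pow hn]
  rw [← Finset.sum_mul, diffMult, cesaro, smul_eq_mul]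
  ring

lemma diffOp_zero (n : ℕ) (f : Vertex n → ℝ) : diffOp n 0 f = 0 := by
  ext x
  have : sphere x 0 = {x} := by ext y; simp [mem_sphere, eq_comm]
  simp [diffOp, ergodicAvg, sphereMean_apply, this]

/-! ### The square function -/

/-- The square function controlling the spherical means of even radius. -/
noncomputable def squareFun {n : ℕ} (M : ℕ) (f : Vertex n → ℝ) (x : Vertex n) : ℝ :=
  ∑ i ∈ Finset.range M, ((i + 1) * (diffOp n (i + 1) f x - diffOp n i f x) ^ 2
    + diffOp n (i + 1) f x ^ 2 / (i + 1))

/-- Telescoping from radius zero, where the difference vanishes: a² - b² ≤ 2a(a - b), and the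
weights i + 1 and 1/(i + 1) split this product. -/
lemma sq_diffOp_le {n : ℕ} (f : Vertex n → ℝ) (x : Vertex n) (j : ℕ) :
    diffOp n j f x ^ 2 ≤ squareFun j f x := by
  induction j with
  | zero => simp [diffOp_zero, squareFun]
  | succ i ih =>
    rw [squareFun, Finset.sum_range_succ, ← squareFun]
    set a := diffOp n (i + 1) f x
    set b := diffOp n i f x
    have hp : (0 : ℝ) < i + 1 := by positivity
    have : a ^ 2 - b ^ 2 ≤ (i + 1) * (a - b) ^ 2 + a ^ 2 / (i + 1) := by
      have h : 0 ≤ (i + 1) * (a - b - a / (i + 1)) ^ 2 := by positivity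
      have e : (i + 1) * (a - b - a / (i + 1)) ^ 2
          = (i + 1) * (a - b) ^ 2 + a ^ 2 / (i + 1) - 2 * (a - b) * a := by
        field_simp
        ring
      nlinarith [sq_nonneg (a - b)]
    linarith

lemma squareFun_mono {n : ℕ} (f : Vertex n → ℝ) (x : Vertex n) {j M : ℕ} (h : j ≤ M) :
    squareFun j f x ≤ squareFun M f x :=
  Finset.sum_le_sum_of_subset_of_nonneg (Finset.range_subset_range.2 h) fun i _ _ => by positivity

lemma sum_squareFun_le {n : ℕ} (hn : 0 < n) {M : ℕ} (hM : 4 * M ≤ n) (f : Vertex n → ℝ) :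
    ∑ x, squareFun M f x ≤ 4 * 4194306 ^ 2 * ∑ x, f x ^ 2 := by
  have hp : (0 : ℝ) < 2 ^ n := by positivity
  refine le_of_mul_le_mul_left ?_ hp
  have e1 : ∀ i, 2 ^ n * ∑ x, (diffOp n (i + 1) f x - diffOp n i f x) ^ 2
      = ∑ S : Finset (Fin n), (diffMult n (i + 1) S.card - diffMult n i S.card) ^ 2 * fourier S f ^ 2 := by
    intro i
    have := parseval (diffOp n (i + 1) f - diffOp n i f)
    simp only [Pi.sub_apply] at this
    rw [← this]
    refine Finset.sum_congr rfl fun S _ => ?_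
    rw [map_sub, fourier_diffOp hn, fourier_diffOp hn]
    ring
  have e2 : ∀ i, 2 ^ n * ∑ x, diffOp n (i + 1) f x ^ 2
      = ∑ S : Finset (Fin n), diffMult n (i + 1) S.card ^ 2 * fourier S f ^ 2 := by
    intro i
    rw [← parseval]
    refine Finset.sum_congr rfl fun S _ => ?_
    rw [fourier_diffOp hn]
    ring
  calc 2 ^ n * ∑ x, squareFun M f x
      = ∑ i ∈ Finset.range M, ((i + 1) * (2 ^ n * ∑ x, (diffOp n (i + 1) f x - diffOp n i f x) ^ 2)
        + (2 ^ n * ∑ x, diffOp n (i + 1) f x ^ 2) / (i + 1)) := by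
        simp only [squareFun]
        rw [Finset.sum_comm, Finset.mul_sum]
        refine Finset.sum_congr rfl fun i _ => ?_
        rw [Finset.sum_add_distrib, ← Finset.mul_sum, ← Finset.sum_div]
        ring
    _ = ∑ S : Finset (Fin n), (∑ i ∈ Finset.range M,
        ((i + 1) * (diffMult n (i + 1) S.card - diffMult n i S.card) ^ 2
          + diffMult n (i + 1) S.card ^ 2 / (i + 1))) * fourier S f ^ 2 := by
        simp only [e1, e2, Finset.sum_mul]
        rw [Finset.sum_comm]
        refine Finset.sum_congr rfl fun i _ => ?_
        rw [Finset.mul_sum, Finset.sum_div, ← Finset.sum_add_distrib]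
        exact Finset.sum_congr rfl fun S _ => by ring
    _ ≤ ∑ S : Finset (Fin n), 4 * 4194306 ^ 2 * fourier S f ^ 2 := by
        refine Finset.sum_le_sum fun S _ => ?_
        have hS : S.card ≤ n := by simpa using Finset.card_le_univ S
        exact mul_le_mul_of_nonneg_right (square_function_mult_le hn hS hM) (sq_nonneg _)
    _ = _ := by rw [← Finset.mul_sum, parseval]; ring

/-! ### Maximal ergodic inequality -/

section Hopf
variable {V : Type*} [Fintype V] {Q : Module.End ℝ (V → ℝ)}
  (hpos : ∀ f, 0 ≤ f → 0 ≤ Q f) (hsum : ∀ f, ∑ x, Q f x = ∑ x, f x)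
include hpos hsum

/-- Hopf's maximal ergodic lemma on a finite set. -/
lemma exists_maximal_set (h : V → ℝ) (M : ℕ) :
    ∃ E : Finset V, 0 ≤ ∑ x ∈ E, h x ∧
      ∀ x, ∀ k ≤ M, 0 < (∑ i ∈ Finset.range (k + 1), Q ^ i) h x → x ∈ E := by
  classical
  set P : ℕ → V → ℝ := fun m => (∑ i ∈ Finset.range m, Q ^ i) h with hP
  have hP0 : P 0 = 0 := by simp [hP]
  have hPs : ∀ m, P (m + 1) = h + Q (P m) := by
    intro m
    simp only [hP]
    rw [Finset.sum_range_succ']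
    simp only [pow_succ', pow_zero, LinearMap.add_apply, LinearMap.sum_apply, Module.End.mul_apply,
      Module.End.one_apply, map_sum]
    rw [add_comm]
  have hne : (Finset.range (M + 2)).Nonempty := ⟨0, by simp⟩
  -- The empty sum m = 0 is included, which makes H nonnegative.
  set H : V → ℝ := fun x => (Finset.range (M + 2)).sup' hne fun m => P m x with hH
  have hle : ∀ m ∈ Finset.range (M + 2), P m ≤ H := fun m hm x =>
    Finset.le_sup' (fun m => P m x) hm
  have hH0 : 0 ≤ H := by
    have := hle 0 (by simp)
    rwa [hP0] at this
  have hQ0 : 0 ≤ Q H := hpos H hH0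
  -- Garsia's argument: a positive maximum is attained at some h + Q P_m, and P_m ≤ H with Q
  -- positive.
  have key : ∀ x, 0 < H x → H x - Q H x ≤ h x := by
    intro x hx
    obtain ⟨m, hm, hmx⟩ := Finset.exists_mem_eq_sup' hne fun m => P m x
    change H x = P m x at hmx
    rcases m with _ | m
    · rw [hP0] at hmx
      simp [hmx] at hx
    · have h1 := hpos (H - P m) (sub_nonneg.2 (hle m (by simp at hm ⊢; omega))) x
      rw [map_sub, Pi.zero_apply, Pi.sub_apply] at h1
      rw [hmx, hPs, Pi.add_apply]
      linarith
  refine ⟨Finset.univ.filter fun x => 0 < H x, ?_, ?_⟩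
  · calc (0 : ℝ) = ∑ x, (H x - Q H x) := by rw [Finset.sum_sub_distrib, hsum, sub_self]
      _ = ∑ x ∈ Finset.univ.filter (fun x => 0 < H x), (H x - Q H x)
          + ∑ x ∈ Finset.univ.filter (fun x => ¬ 0 < H x), (H x - Q H x) :=
          (Finset.sum_filter_add_sum_filter_not _ _ _).symm
      _ ≤ ∑ x ∈ Finset.univ.filter (fun x => 0 < H x), h x + 0 := by
          refine add_le_add (Finset.sum_le_sum fun x hx => key x (Finset.mem_filter.1 hx).2) ?_
          refine Finset.sum_nonpos fun x hx => ?_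
          have := (Finset.mem_filter.1 hx).2
          have := hQ0 x
          simp only [Pi.zero_apply] at this
          linarith
      _ = _ := add_zero _
  · intro x k hk hx
    simp only [Finset.mem_filter, Finset.mem_univ, true_and]
    exact hx.trans_le (hle (k + 1) (by simp; omega) x)

/-- The weak type `(1, 1)` maximal inequality for ergodic averages on a finite set. -/
lemma exists_ergodicAvg_le (hone : Q 1 = 1) {g : V → ℝ} (hg : 0 ≤ g) (c : ℝ) (M : ℕ) :
    ∃ E : Finset V, c * E.card ≤ ∑ x, g x ∧ ∀ x ∉ E, ∀ k ≤ M, ergodicAvg Q k g x ≤ c := by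
  obtain ⟨E, h1, h2⟩ := exists_maximal_set hpos hsum (g - c • 1) M
  have hpow : ∀ i, (Q ^ i) 1 = 1 := by
    intro i
    induction i with
    | zero => simp
    | succ i ih => rw [pow_succ, Module.End.mul_apply, hone, ih]
  refine ⟨E, ?_, ?_⟩
  · simp only [Pi.sub_apply, Pi.smul_apply, Pi.one_apply, smul_eq_mul, mul_one,
      Finset.sum_sub_distrib, Finset.sum_const, nsmul_eq_mul] at h1
    have := Finset.sum_le_sum_of_subset_of_nonneg (Finset.subset_univ E) (f := g)
      fun i _ _ => hg i
    linarith
  · intro x hx k hk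
    by_contra! hlt
    refine hx (h2 x k hk ?_)
    have hk0 : (0 : ℝ) < k + 1 := by positivity
    rw [ergodicAvg, LinearMap.smul_apply, Pi.smul_apply, smul_eq_mul, lt_inv_mul_iff₀ hk0] at hlt
    have hQ1 : (∑ i ∈ Finset.range (k + 1), Q ^ i) 1 = ((k : ℝ) + 1) • (1 : V → ℝ) := by
      rw [LinearMap.sum_apply, Finset.sum_congr rfl fun i _ => hpow i, Finset.sum_const,
        Finset.card_range, ← Nat.cast_smul_eq_nsmul ℝ, Nat.cast_succ]
    rw [map_sub, map_smul, hQ1]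
    simp only [Pi.sub_apply, Pi.smul_apply, Pi.one_apply, smul_eq_mul, mul_one]
    linarith

end Hopf

/-! ### Even radii up to n/2 -/

lemma twoStep_nonneg {n : ℕ} {f : Vertex n → ℝ} (hf : 0 ≤ f) : 0 ≤ twoStep n f :=
  sphereMean_nonneg 1 (sphereMean_nonneg 1 hf)

lemma exists_sphereMean_even_le {n : ℕ} (hn : 0 < n) {ε : ℝ} (hε : 0 < ε) (hε1 : ε ≤ 1)
    {g : Vertex n → ℝ} (hg : 0 ≤ g) (hg1 : g ≤ 1) (hsum : ∑ x, g x ≤ ε * 2 ^ n) :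
    ∃ x, ∀ j, 4 * j ≤ n → sphereMean (2 * j) g x ≤ 16777300 * √ε := by
  classical
  have hs : 0 < √ε := Real.sqrt_pos.2 hε
  have hs1 : √ε ≤ 1 := Real.sqrt_le_one.2 hε1
  have hss : √ε * √ε = ε := Real.mul_self_sqrt hε.le
  have hp : (0 : ℝ) < 2 ^ n := by positivity
  -- The levels 4√ε here and (4 · 4194306)²ε for the square function each leave an exceptional set
  -- of at most a quarter of the cube.
  obtain ⟨E₁, hE₁, hU⟩ := exists_ergodicAvg_le (Q := twoStep n) (fun f hf => twoStep_nonneg hf)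
    (fun f => by rw [twoStep, LinearMap.comp_apply, sum_sphereMean hn, sum_sphereMean hn])
    (by rw [twoStep, LinearMap.comp_apply, sphereMean_one hn, sphereMean_one hn]) hg (4 * √ε) (n / 4)
  set E₂ : Finset (Vertex n) :=
    Finset.univ.filter fun x => (4 * 4194306) ^ 2 * ε < squareFun (n / 4) g x with hE₂
  have h1 : (E₁.card : ℝ) ≤ 2 ^ n / 4 := by
    have : 4 * √ε * E₁.card ≤ 4 * √ε * (2 ^ n / 4) := by
      calc 4 * √ε * E₁.card ≤ √ε * √ε * 2 ^ n := by rw [hss]; exact hE₁.trans hsum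
        _ ≤ √ε * 1 * 2 ^ n := by gcongr
        _ = _ := by ring
    exact le_of_mul_le_mul_left this (by positivity)
  have h2 : (E₂.card : ℝ) ≤ 2 ^ n / 4 := by
    have hsq : ∑ x, g x ^ 2 ≤ ε * 2 ^ n := by
      refine (Finset.sum_le_sum fun x _ => ?_).trans hsum
      have a := hg x
      have b := hg1 x
      simp only [Pi.zero_apply, Pi.one_apply] at a b
      nlinarith
    have a := Finset.card_nsmul_le_sum E₂ (squareFun (n / 4) g) ((4 * 4194306) ^ 2 * ε)
      fun x hx => (Finset.mem_filter.1 hx).2.le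
    have b := Finset.sum_le_sum_of_subset_of_nonneg (Finset.subset_univ E₂)
      (f := squareFun (n / 4) g) fun x _ _ => Finset.sum_nonneg fun i _ => by positivity
    have c := sum_squareFun_le hn (M := n / 4) (by omega) g
    rw [nsmul_eq_mul] at a
    have : (4 * 4194306) ^ 2 * ε * E₂.card ≤ (4 * 4194306) ^ 2 * ε * (2 ^ n / 4) := by nlinarith
    exact le_of_mul_le_mul_left this (by positivity)
  obtain ⟨x, hx⟩ : ∃ x, x ∉ E₁ ∪ E₂ := by
    by_contra! h
    have hu : E₁ ∪ E₂ = Finset.univ := Finset.eq_univ_iff_forall.2 h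
    have hc := Finset.card_union_le E₁ E₂
    rw [hu, Finset.card_univ, Fintype.card_fun, Fintype.card_bool, Fintype.card_fin] at hc
    have hc' : (2 : ℝ) ^ n ≤ E₁.card + E₂.card := by exact_mod_cast hc
    linarith
  rw [Finset.notMem_union] at hx
  refine ⟨x, fun j hj => ?_⟩
  have u := hU x hx.1 j (by omega)
  have v : squareFun (n / 4) g x ≤ (4 * 4194306) ^ 2 * ε := by
    by_contra! hlt
    exact hx.2 (Finset.mem_filter.2 ⟨Finset.mem_univ _, hlt⟩)
  have w : diffOp n j g x ^ 2 ≤ (4 * 4194306 * √ε) ^ 2 := by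
    rw [mul_pow, Real.sq_sqrt hε.le]
    exact (sq_diffOp_le g x j).trans ((squareFun_mono g x (by omega)).trans v)
  have d := le_of_abs_le (abs_le_of_sq_le_sq w (by positivity))
  rw [diffOp, LinearMap.sub_apply, Pi.sub_apply] at d
  linarith

/-! ### Odd radii, large radii and the vertex statement -/

/-- Flip one coordinate. -/
def flip {n : ℕ} (z : Vertex n) (i : Fin n) : Vertex n := Function.update z i (!z i)

lemma flip_injective {n : ℕ} (z : Vertex n) : Function.Injective (flip z) := by
  intro i j h
  by_contra hij
  have := congrFun h i
  simp [flip, Function.update_of_ne hij] at this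

lemma hammingDist_flip {n : ℕ} (x z : Vertex n) (i : Fin n) :
    (x i ≠ z i → hammingDist x (flip z i) + 1 = hammingDist x z) ∧
    (x i = z i → hammingDist x (flip z i) = hammingDist x z + 1) := by
  have e : ∀ y : Vertex n, hammingDist x y = ∑ j, if x j ≠ y j then 1 else 0 := by
    intro y; rw [hammingDist, Finset.card_filter]
  have e2 : ∑ j ∈ Finset.univ.erase i, (if x j ≠ flip z i j then 1 else 0)
      = ∑ j ∈ Finset.univ.erase i, (if x j ≠ z j then 1 else 0) := by
    refine Finset.sum_congr rfl fun j hj => ?_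
    rw [flip, Function.update_of_ne (Finset.ne_of_mem_erase hj)]
  rw [e, e, ← Finset.add_sum_erase _ _ (Finset.mem_univ i),
    ← Finset.add_sum_erase _ _ (Finset.mem_univ i), e2]
  have e3 : flip z i i = !z i := by simp [flip]
  rw [e3]
  constructor <;> intro h <;> cases hx : x i <;> cases hz : z i <;> simp_all <;> omega

lemma sphere_one_eq {n : ℕ} (z : Vertex n) : sphere z 1 = Finset.univ.image (flip z) := by
  refine (Finset.eq_of_subset_of_card_le ?_ ?_).symm
  · intro y hy
    obtain ⟨i, -, rfl⟩ := Finset.mem_image.1 hy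
    rw [mem_sphere, (hammingDist_flip z z i).2 rfl, hammingDist_self]
  · rw [card_sphere, Finset.card_image_of_injective _ (flip_injective z)]
    simp

lemma hammingDist_of_adj {n : ℕ} (x : Vertex n) {y z : Vertex n} (h : hammingDist y z = 1) :
    hammingDist x z = hammingDist x y + 1 ∨ hammingDist x y = hammingDist x z + 1 := by
  have : z ∈ sphere y 1 := mem_sphere.2 h
  rw [sphere_one_eq] at this
  obtain ⟨i, -, rfl⟩ := Finset.mem_image.1 this
  have := hammingDist_flip x y i
  by_cases hi : x i = y i
  · exact Or.inl (this.2 hi)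
  · exact Or.inr (this.1 hi).symm

lemma card_sphere_one_inter {n k : ℕ} {x z : Vertex n} (h : hammingDist x z = k + 1) :
    (sphere z 1 ∩ sphere x k).card = k + 1 := by
  have : sphere z 1 ∩ sphere x k = (Finset.univ.filter fun i => x i ≠ z i).image (flip z) := by
    rw [sphere_one_eq]
    ext y
    simp only [Finset.mem_inter, Finset.mem_image, Finset.mem_univ, true_and, Finset.mem_filter,
      mem_sphere]
    constructor
    · rintro ⟨⟨i, rfl⟩, hk⟩
      refine ⟨i, fun hi => ?_, rfl⟩
      have := (hammingDist_flip x z i).2 hi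
      omega
    · rintro ⟨i, hi, rfl⟩
      have := (hammingDist_flip x z i).1 hi
      exact ⟨⟨i, rfl⟩, by omega⟩
  rw [this, Finset.card_image_of_injective _ (flip_injective z), ← h]
  rfl

lemma choose_succ_mul_cast {n k : ℕ} (hk : k ≤ n) :
    (n.choose (k + 1) : ℝ) * (k + 1) = n.choose k * (n - k) := by
  rw [← Nat.cast_sub hk]
  exact_mod_cast Nat.choose_succ_right_eq n k

/-- A vertex at distance k + 1 has k + 1 neighbours at distance k. Counting these steps loses only
the factor n/(n - k), at most 2 in this range. -/
lemma sphereMean_succ_le {n k : ℕ} (hn : 0 < n) (hk : 2 * k ≤ n) {f : Vertex n → ℝ} (hf : 0 ≤ f)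
    (x : Vertex n) : sphereMean (k + 1) f x ≤ 2 * sphereMean k (sphereMean 1 f) x := by
  have hn' : (0 : ℝ) < n := by exact_mod_cast hn
  have hk' : 2 * (k : ℝ) ≤ n := by exact_mod_cast hk
  have h1 : (k + 1) * ∑ z ∈ sphere x (k + 1), f z ≤ ∑ y ∈ sphere x k, ∑ z ∈ sphere y 1, f z := by
    calc (k + 1) * ∑ z ∈ sphere x (k + 1), f z
        = ∑ z ∈ sphere x (k + 1), ∑ y ∈ sphere z 1 ∩ sphere x k, f z := by
          rw [Finset.mul_sum]
          refine Finset.sum_congr rfl fun z hz => ?_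
          rw [Finset.sum_const, card_sphere_one_inter (mem_sphere.1 hz), nsmul_eq_mul]
          push_cast
          rfl
      _ ≤ ∑ z, ∑ y ∈ sphere z 1 ∩ sphere x k, f z :=
          Finset.sum_le_sum_of_subset_of_nonneg (Finset.subset_univ _)
            fun z _ _ => Finset.sum_nonneg fun y _ => hf z
      _ = _ := Finset.sum_comm' fun z y => by
          simp [mem_sphere_comm (x := z), and_comm]
  simp only [sphereMean_apply]
  rw [← Finset.sum_div, Nat.choose_one_right]
  have hc : (0 : ℝ) < n.choose k := choose_cast_pos (by omega)
  have hc1 : (0 : ℝ) < n.choose (k + 1) := choose_cast_pos (by omega)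
  have hid := choose_succ_mul_cast (n := n) (k := k) (by omega)
  set s := ∑ z ∈ sphere x (k + 1), f z with hs
  have hs0 : 0 ≤ s := Finset.sum_nonneg fun y _ => hf y
  have hle : s / n.choose (k + 1) ≤ 2 * ((k + 1) * s / n / n.choose k) := by
    have : 2 * ((k + 1) * s / n / n.choose k) = 2 * (k + 1) * s / (n * n.choose k) := by
      rw [div_div]; ring
    rw [this, div_le_div_iff₀ hc1 (by positivity)]
    have : 2 * (k + 1) * s * n.choose (k + 1) = s * n.choose k * (2 * (n - k)) := by
      linear_combination 2 * s * hid
    rw [this]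
    have h0 : 0 ≤ s * n.choose k := by positivity
    nlinarith
  refine hle.trans ?_
  gcongr

/-- The antipodal vertex. -/
def antipode {n : ℕ} (x : Vertex n) : Vertex n := fun i => !x i

lemma antipode_antipode {n : ℕ} (x : Vertex n) : antipode (antipode x) = x := by
  ext i; simp [antipode]

lemma hammingDist_antipode {n : ℕ} (x y : Vertex n) :
    hammingDist x (antipode y) + hammingDist x y = n := by
  have := Finset.card_filter_add_card_filter_not (s := (Finset.univ : Finset (Fin n))) (fun i => x i ≠ y i)
  rw [Finset.card_univ, Fintype.card_fin] at this
  rw [hammingDist, hammingDist, add_comm]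
  convert this using 3
  ext i
  cases hx : x i <;> cases hy : y i <;> simp [antipode, hx, hy]

lemma sphereMean_sub {n k : ℕ} (hk : k ≤ n) (f : Vertex n → ℝ) (x : Vertex n) :
    sphereMean (n - k) f x = sphereMean k (f ∘ antipode) x := by
  rw [sphereMean_apply, sphereMean_apply, Nat.choose_symm hk]
  congr 1
  refine Finset.sum_nbij' antipode antipode ?_ ?_ ?_ ?_ ?_
  · intro y hy
    have := hammingDist_antipode x y
    rw [mem_sphere] at hy ⊢
    omega
  · intro y hy
    have := hammingDist_antipode x y
    rw [mem_sphere] at hy ⊢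
    omega
  · intro y _; exact antipode_antipode y
  · intro y _; exact antipode_antipode y
  · intro y _; simp [antipode_antipode]

lemma sum_comp_antipode {n : ℕ} (f : Vertex n → ℝ) : ∑ x, (f ∘ antipode) x = ∑ x, f x :=
  Finset.sum_nbij' antipode antipode (by simp) (by simp) (fun y _ => antipode_antipode y)
    (fun y _ => antipode_antipode y) (fun y _ => rfl)

lemma sphereMean_le_one {n k : ℕ} (hk : k ≤ n) {f : Vertex n → ℝ} (hf : f ≤ 1) :
    sphereMean k f ≤ 1 := by
  have := sphereMean_nonneg k (sub_nonneg.2 hf)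
  rwa [map_sub, sphereMean_one hk, sub_nonneg] at this

/-- A function with small mean has all its spherical means small about some vertex. -/
theorem exists_sphereMean_le {n : ℕ} (hn : 0 < n) {ε : ℝ} (hε : 0 < ε) (hε1 : ε ≤ 1)
    {f : Vertex n → ℝ} (hf : 0 ≤ f) (hf1 : f ≤ 1) (hsum : ∑ x, f x ≤ ε * 2 ^ n) :
    ∃ x, ∀ k ≤ n, sphereMean k f x ≤ 134218400 * √ε := by
  set f' := f ∘ antipode with hf'
  have hf0' : 0 ≤ f' := fun x => hf (antipode x)
  have hf1' : f' ≤ 1 := fun x => hf1 (antipode x)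
  have t0 := sphereMean_nonneg 1 hf
  have t1 := sphereMean_le_one hn hf1
  have t0' := sphereMean_nonneg 1 hf0'
  have t1' := sphereMean_le_one hn hf1'
  -- All four functions are nonnegative with the same sum, so a bound for g at one vertex bounds
  -- each of them there, at the cost of a factor 4.
  set g : Vertex n → ℝ := (1 / 4 : ℝ) • (f + sphereMean 1 f + f' + sphereMean 1 f') with hg
  have hgx : ∀ x, g x = 1 / 4 * (f x + sphereMean 1 f x + f' x + sphereMean 1 f' x) := fun x => rfl
  have hs0 : 0 ≤ √ε := Real.sqrt_nonneg _
  obtain ⟨x, hx⟩ := exists_sphereMean_even_le hn hε hε1 (g := g)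
    (by
      intro x
      have a := hf x; have b := hf0' x; have c := t0 x; have d := t0' x
      simp only [Pi.zero_apply] at a b c d ⊢
      rw [hgx]; linarith)
    (by
      intro x
      have a := hf1 x; have b := hf1' x; have c := t1 x; have d := t1' x
      simp only [Pi.one_apply] at a b c d ⊢
      rw [hgx]; linarith)
    (by
      simp only [hgx]
      rw [← Finset.mul_sum, Finset.sum_add_distrib, Finset.sum_add_distrib, Finset.sum_add_distrib,
        sum_sphereMean hn, sum_sphereMean hn, hf', sum_comp_antipode]
      linarith)
  have half : ∀ h : Vertex n → ℝ, 0 ≤ h →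
      (∀ j, 4 * j ≤ n → sphereMean (2 * j) h x ≤ 67109200 * √ε) →
      (∀ j, 4 * j ≤ n → sphereMean (2 * j) (sphereMean 1 h) x ≤ 67109200 * √ε) →
      ∀ k, 2 * k ≤ n → sphereMean k h x ≤ 134218400 * √ε := by
    intro h h0 a b k hk
    rcases Nat.even_or_odd' k with ⟨j, rfl | rfl⟩
    · have := a j (by omega)
      linarith
    · have := b j (by omega)
      have := sphereMean_succ_le hn (k := 2 * j) (by omega) h0 x
      linarith
  have hx' : ∀ j, 4 * j ≤ n → sphereMean (2 * j) f x + sphereMean (2 * j) (sphereMean 1 f) x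
      + sphereMean (2 * j) f' x + sphereMean (2 * j) (sphereMean 1 f') x ≤ 67109200 * √ε := by
    intro j hj
    have := hx j hj
    rw [hg, map_smul, map_add, map_add, map_add] at this
    simp only [Pi.smul_apply, Pi.add_apply, smul_eq_mul] at this
    linarith
  have p : ∀ j, ∀ h : Vertex n → ℝ, 0 ≤ h → 0 ≤ sphereMean j h x := fun j h h0 =>
    sphereMean_nonneg j h0 x
  refine ⟨x, fun k hk => ?_⟩
  rcases le_total (2 * k) n with h | h
  · refine half f hf (fun j hj => ?_) (fun j hj => ?_) k h <;>
      linarith [hx' j hj, p (2 * j) f hf, p (2 * j) _ t0, p (2 * j) f' hf0', p (2 * j) _ t0']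
  · rw [← Nat.sub_sub_self hk, sphereMean_sub (Nat.sub_le _ _)]
    refine half f' hf0' (fun j hj => ?_) (fun j hj => ?_) (n - k) (by omega) <;>
      linarith [hx' j hj, p (2 * j) f hf, p (2 * j) _ t0, p (2 * j) f' hf0', p (2 * j) _ t0']

lemma vertex_statement {ε : ℝ} (hε1 : ε < 1) (n : ℕ) (F : Finset (Vertex n))
    (hF : (F.card : ℝ) < ε * 2 ^ n) :
    ∃ x : Vertex n, ∀ k : ℕ, k ≤ n → fraction F (sphere x k) ≤ 134218400 * √ε := by
  have hε : 0 < ε := pos_of_mul_pos_left ((Nat.cast_nonneg _).trans_lt hF) (by positivity)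
  rcases Nat.eq_zero_or_pos n with rfl | hn
  · have : F = ∅ := by
      rw [← Finset.card_eq_zero]
      rw [pow_zero, mul_one] at hF
      have : (F.card : ℝ) < 1 := hF.trans hε1
      have : F.card < 1 := by exact_mod_cast this
      omega
    refine ⟨fun _ => false, fun k _ => ?_⟩
    rw [this, fraction]
    simp
  obtain ⟨x, hx⟩ := exists_sphereMean_le hn hε hε1.le (f := fun y => if y ∈ F then 1 else 0)
    (fun y => by dsimp only; split_ifs <;> simp) (fun y => by dsimp only; split_ifs <;> simp)
    (by simpa using hF.le)
  refine ⟨x, fun k hk => ?_⟩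
  have := hx k hk
  rw [sphereMean_apply, Finset.sum_boole, Finset.filter_mem_eq_inter] at this
  rwa [fraction, card_sphere]

/-! ### Edges -/

lemma mem_edgeSphere_mk {n k : ℕ} {x y z : Vertex n} :
    s(y, z) ∈ edgeSphere x k ↔
      hammingDist y z = 1 ∧ min (hammingDist x y) (hammingDist x z) = k := by
  rw [edgeSphere, Finset.mem_filter, SimpleGraph.mem_edgeFinset, SimpleGraph.mem_edgeSet]
  rfl

lemma exists_endpoints {n k : ℕ} {x : Vertex n} {e : Sym2 (Vertex n)} (he : e ∈ edgeSphere x k) :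
    ∃ y ∈ sphere x k, ∃ z ∈ sphere x (k + 1), e = s(y, z) := by
  induction e using Sym2.ind with
  | _ y z =>
    obtain ⟨h1, h2⟩ := mem_edgeSphere_mk.1 he
    rcases hammingDist_of_adj x h1 with h | h
    · exact ⟨y, mem_sphere.2 (by omega), z, mem_sphere.2 (by omega), rfl⟩
    · exact ⟨z, mem_sphere.2 (by omega), y, mem_sphere.2 (by omega), Sym2.eq_swap⟩

/-- Each vertex at distance k + 1 has k + 1 edges towards x, and an edge determines its far
endpoint. -/
lemma le_card_edgeSphere {n : ℕ} (x : Vertex n) (k : ℕ) :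
    n.choose (k + 1) * (k + 1) ≤ (edgeSphere x k).card := by
  have h : ((sphere x (k + 1)).sigma fun z => sphere z 1 ∩ sphere x k).card
      = n.choose (k + 1) * (k + 1) := by
    rw [Finset.card_sigma, Finset.sum_congr rfl fun z hz => card_sphere_one_inter (mem_sphere.1 hz),
      Finset.sum_const, card_sphere, smul_eq_mul]
  rw [← h]
  refine Finset.card_le_card_of_injOn (fun p => s(p.2, p.1)) ?_ ?_
  · rintro ⟨z, y⟩ hp
    simp only [Finset.coe_sigma, Set.mem_sigma_iff, Finset.mem_coe, Finset.mem_inter,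
      mem_sphere] at hp
    refine Finset.mem_coe.2 (mem_edgeSphere_mk.2 ⟨?_, ?_⟩)
    · rw [hammingDist_comm]; exact hp.2.1
    · dsimp only; omega
  · rintro ⟨z, y⟩ hp ⟨z', y'⟩ hp' h
    simp only [Finset.coe_sigma, Set.mem_sigma_iff, Finset.mem_coe, Finset.mem_inter,
      mem_sphere] at hp hp'
    simp only [Sym2.eq_iff] at h
    rcases h with ⟨rfl, rfl⟩ | ⟨rfl, rfl⟩
    · rfl
    · omega

/-- The fraction of the `n` edges at a vertex that lie in `F'`. -/
noncomputable def edgeDensity {n : ℕ} (F' : Finset (Sym2 (Vertex n))) (y : Vertex n) : ℝ :=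
  ((F'.filter fun e => y ∈ e).card : ℝ) / n

lemma edgeDensity_nonneg {n : ℕ} (F' : Finset (Sym2 (Vertex n))) : 0 ≤ edgeDensity F' :=
  fun _ => div_nonneg (Nat.cast_nonneg _) (Nat.cast_nonneg _)

lemma edgeDensity_le_one {n : ℕ} {F' : Finset (Sym2 (Vertex n))} (hF : F' ⊆ (graph n).edgeFinset) :
    edgeDensity F' ≤ 1 := by
  intro y
  refine div_le_one_of_le₀ ?_ (Nat.cast_nonneg _)
  have h : (F'.filter fun e => y ∈ e) ⊆ (sphere y 1).image fun z => s(y, z) := by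
    intro e he
    obtain ⟨h1, h2⟩ := Finset.mem_filter.1 he
    obtain ⟨z, rfl⟩ := h2
    have := hF h1
    rw [SimpleGraph.mem_edgeFinset, SimpleGraph.mem_edgeSet] at this
    exact Finset.mem_image_of_mem _ (mem_sphere.2 this)
  have := (Finset.card_le_card h).trans Finset.card_image_le
  rw [card_sphere, Nat.choose_one_right] at this
  exact Nat.cast_le.2 this

lemma sum_card_filter_mem_le {V : Type*} [Fintype V] [DecidableEq V] (F' : Finset (Sym2 V)) :
    ∑ y, (F'.filter fun e => y ∈ e).card ≤ F'.card * 2 := by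
  simp only [Finset.card_filter]
  rw [Finset.sum_comm]
  refine Finset.sum_le_card_nsmul _ _ _ fun e _ => ?_
  rw [← Finset.card_filter]
  induction e using Sym2.ind with
  | _ a b =>
    have : (Finset.univ.filter fun y => y ∈ s(a, b)) = {a, b} := by ext y; simp
    rw [this]
    exact Finset.card_le_two

lemma card_edgeSphere_inter_le {n k : ℕ} (hn : 0 < n) (x : Vertex n) (F' : Finset (Sym2 (Vertex n)))
    {j : ℕ} (h : ∀ e ∈ edgeSphere x k, ∃ y ∈ sphere x j, y ∈ e) :
    ((edgeSphere x k ∩ F').card : ℝ) ≤ n * ∑ y ∈ sphere x j, edgeDensity F' y := by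
  have hn' : (n : ℝ) ≠ 0 := by positivity
  have hsub : edgeSphere x k ∩ F' ⊆ (sphere x j).biUnion fun y => F'.filter fun e => y ∈ e := by
    intro e he
    obtain ⟨h1, h2⟩ := Finset.mem_inter.1 he
    obtain ⟨y, hy, hye⟩ := h e h1
    exact Finset.mem_biUnion.2 ⟨y, hy, Finset.mem_filter.2 ⟨h2, hye⟩⟩
  have := (Finset.card_le_card hsub).trans Finset.card_biUnion_le
  simp only [edgeDensity]
  rw [← Finset.sum_div, mul_div_cancel₀ _ hn']
  exact_mod_cast this

/-- Edges are charged to an endpoint at distance j; the hypothesis `hc` says that the edge sphere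
holds at least half as many edges as there are incidences at those endpoints. -/
lemma fraction_le_of_le {n k j : ℕ} (hn : 0 < n) {x : Vertex n} {F' : Finset (Sym2 (Vertex n))}
    (hj : j ≤ n) (h : ∀ e ∈ edgeSphere x k, ∃ y ∈ sphere x j, y ∈ e)
    (hc : (n : ℝ) * n.choose j ≤ 2 * (edgeSphere x k).card) :
    fraction F' (edgeSphere x k) ≤ 2 * sphereMean j (edgeDensity F') x := by
  have hn' : (0 : ℝ) < n := by exact_mod_cast hn
  have hcj : (0 : ℝ) < n.choose j := choose_cast_pos hj
  have hpos : (0 : ℝ) < (edgeSphere x k).card := by nlinarith [mul_pos hn' hcj]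
  have h1 := card_edgeSphere_inter_le hn x F' h
  rw [fraction, sphereMean_apply, mul_div_assoc', div_le_div_iff₀ hpos hcj]
  have hs : 0 ≤ ∑ y ∈ sphere x j, edgeDensity F' y :=
    Finset.sum_nonneg fun y _ => edgeDensity_nonneg F' y
  calc _ ≤ n * (∑ y ∈ sphere x j, edgeDensity F' y) * n.choose j := by gcongr
    _ = (∑ y ∈ sphere x j, edgeDensity F' y) * (n * n.choose j) := by ring
    _ ≤ (∑ y ∈ sphere x j, edgeDensity F' y) * (2 * (edgeSphere x k).card) := by gcongr
    _ = _ := by ring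

lemma edge_statement {ε : ℝ} (hε1 : ε < 1 / 2) (n : ℕ) (F' : Finset (Sym2 (Vertex n)))
    (hF : F' ⊆ (graph n).edgeFinset) (hcard : (F'.card : ℝ) < ε * n * 2 ^ n) :
    ∃ x : Vertex n, ∀ k : ℕ, k < n → fraction F' (edgeSphere x k) ≤ 536873600 * √ε := by
  have hpos : 0 < ε * n :=
    pos_of_mul_pos_left ((Nat.cast_nonneg _).trans_lt hcard) (by positivity)
  have hε : 0 < ε := pos_of_mul_pos_left hpos (Nat.cast_nonneg _)
  have hn' : (0 : ℝ) < n := pos_of_mul_pos_right hpos hε.le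
  have hn : 0 < n := by exact_mod_cast hn'
  -- Each edge is seen from two endpoints, so the mean density is at most 2ε; hence the bound 1/2 on
  -- ε.
  obtain ⟨x, hx⟩ := exists_sphereMean_le hn (ε := 2 * ε) (by linarith) (by linarith)
    (edgeDensity_nonneg F') (edgeDensity_le_one hF) (by
      simp only [edgeDensity]
      rw [← Finset.sum_div, div_le_iff₀ hn']
      have : ((∑ y, (F'.filter fun e => y ∈ e).card : ℕ) : ℝ) ≤ (F'.card * 2 : ℕ) := by
        exact_mod_cast sum_card_filter_mem_le F'
      push_cast at this
      linarith)
  have hs : √(2 * ε) ≤ 2 * √ε := by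
    rw [Real.sqrt_le_left (by positivity), mul_pow, Real.sq_sqrt hε.le]
    linarith
  refine ⟨x, fun k hk => ?_⟩
  have hE : ((n.choose (k + 1) * (k + 1) : ℕ) : ℝ) ≤ (edgeSphere x k).card := by
    exact_mod_cast le_card_edgeSphere x k
  push_cast at hE
  have hid := choose_succ_mul_cast (n := n) (k := k) hk.le
  have key : ∃ j ≤ n, fraction F' (edgeSphere x k) ≤ 2 * sphereMean j (edgeDensity F') x := by
    -- The near endpoints see a proportion (n - k)/n of their edges in the sphere and the far ones
    -- (k + 1)/n; the larger is at least one half.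
    rcases le_total (2 * k) n with h | h
    · have hk' : 2 * (k : ℝ) ≤ n := by exact_mod_cast h
      refine ⟨k, hk.le, fraction_le_of_le hn hk.le (fun e he => ?_) ?_⟩
      · obtain ⟨y, hy, z, -, rfl⟩ := exists_endpoints he
        exact ⟨y, hy, by simp⟩
      · have : (0 : ℝ) ≤ n.choose k := Nat.cast_nonneg _
        nlinarith
    · have hk' : (n : ℝ) ≤ 2 * k := by exact_mod_cast h
      refine ⟨k + 1, hk, fraction_le_of_le hn hk (fun e he => ?_) ?_⟩
      · obtain ⟨y, -, z, hz, rfl⟩ := exists_endpoints he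
        exact ⟨z, hz, by simp⟩
      · have : (0 : ℝ) ≤ n.choose (k + 1) := Nat.cast_nonneg _
        nlinarith
  obtain ⟨j, hj, hle⟩ := key
  linarith [hx j hj]

end HammingCube

theorem mainTheorem2 :
    (∃ ε₀ : ℝ, 0 < ε₀ ∧ ∃ C : ℝ, 0 < C ∧
      ∀ ε : ℝ, 0 ≤ ε → ε < ε₀ → ∀ (n : ℕ) (F : Finset (HammingCube.Vertex n)),
        (F.card : ℝ) < ε * 2 ^ n →
          ∃ x : HammingCube.Vertex n, ∀ k : ℕ, k ≤ n →
            HammingCube.fraction F (HammingCube.sphere x k) ≤ C * √ε) ∧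
    (∃ ε₁ : ℝ, 0 < ε₁ ∧ ∃ C : ℝ, 0 < C ∧
      ∀ ε : ℝ, 0 ≤ ε → ε < ε₁ → ∀ (n : ℕ) (F' : Finset (Sym2 (HammingCube.Vertex n))),
        F' ⊆ (HammingCube.graph n).edgeFinset →
        (F'.card : ℝ) < ε * n * 2 ^ n →
          ∃ x : HammingCube.Vertex n, ∀ k : ℕ, k < n →
            HammingCube.fraction F' (HammingCube.edgeSphere x k) ≤ C * √ε) := by
  exact ⟨⟨1, one_pos, 134218400, by norm_num,
      fun _ _ hε1 n F hF => HammingCube.vertex_statement hε1 n F hF⟩,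
    ⟨1 / 2, by norm_num, 536873600, by norm_num,
      fun _ _ hε1 n F' hsub hF => HammingCube.edge_statement hε1 n F' hsub hF⟩⟩
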